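/- Let $0<a<b<1$ with $b<(a+2)/3$ and $b<(2+\sqrt3)\,a$, and let $k>0$. Put $D(u)=(u-a)(u-b)$, $\Phi(u)=\int_1^u D(v)\,dv$, $R(u)=\left(\frac{k^2D(0)}{D(u)}-k^2\right)\Phi(u)$ and $c=-kD(0)$, and consider $u_t=(D(u)u_x)_x+R(u)$. Let $$u_l=\frac{a+b-\sqrt{3(a-b)^2}}2,\qquad u_r=\frac{a+b+\sqrt{3(a-b)^2}}2,$$ which is the unique pair $u_l<u_r$ with $\Phi(u_l)=\Phi(u_r)$ and $\Phi'(u_l)=\Phi'(u_r)$; under the above assumptions $0<u_l<a<b<u_r<1$. In the coordinate $z=x-ct$, let $\bar u$ be the receding shock-fronted travelling wave on $(-\infty,0)$ given by $\Phi(\bar u(z))=\Phi(0)e^{kz}$, with $\bar u(z)\in(u_r,1)$ for $z<z_s$ and $\bar u(z)\in(0,u_l)$ for $z_s<z<0$, where the shock position $z_s<0$ is given by $\Phi(u_l)=\Phi(0)e^{kz_s}$. Let $\mathcal L(\bar u)$ be the linearised operator $$\mathcal L(\bar u)p=(D(\bar u)p)_{zz}+c\,p_z+R'(\bar u)p$$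 in $L^2((-\infty,0);\mathbb C)$, where the derivatives are taken on each side of the shock and the domain consists of all $p$ that are $H^2$ on $(-\infty,z_s)$ and on $(z_s,0)$, are $C^1$ across $z_s$, and satisfy $p(0)=0$ and $\lim_{z\to-\infty}p(z)=0$. Its spectrum $\sigma(\mathcal L(\bar u))$ is the set of $\lambda\in\mathbb C$ for which $\mathcal L(\bar u)-\lambda$ does not have a bounded inverse on $L^2((-\infty,0);\mathbb C)$. Suppose that $$\tfrac12 D(\bar u)_{zz}+R'(\bar u)<0\quad\text{for all values } \bar u=u\in[0,u_l]\cup[u_r,1],$$ where $D(\bar u)_{zz}$ is regarded as a function of the value $u$ of $\bar u$ through $\bar u_z=k\Phi(\bar u)/D(\bar u)$, that is, $D(\bar u)_{zz}=\frac{d}{du}\!\left(D'(u)\frac{k\Phi(u)}{D(u)}\right)\frac{k\Phi(u)}{D(u)}$. Then $\bar u$ is spectrally stable: every $\lambda\in\sigma(\mathcal L(\bar u))$ satisfies $\operatorname{Re}\lambda<0$. -/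

import Mathlib

open MeasureTheory Set Filter Topology

namespace RecedingWave

noncomputable section

/-! ### The model -/

/-- The quadratic diffusivity `D(u) = (u - a)(u - b)`. -/
def diffusivity (a b u : ℝ) : ℝ := (u - a) * (u - b)

/-- The Kirchhoff variable `Φ(u) = ∫_1^u D`, normalised by `Φ(1) = 0`. -/
def kirchhoff (a b u : ℝ) : ℝ := ∫ v in (1 : ℝ)..u, diffusivity a b v

/-- The reaction term `R(u) = (A / D(u) + κ) Φ(u)` with `κ = -k²` and `A = -κ D(0) = k² D(0)`. -/
def reaction (a b k u : ℝ) : ℝ :=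
  (k ^ 2 * diffusivity a b 0 / diffusivity a b u + -k ^ 2) * kirchhoff a b u

/-- The speed `c = -A / k = -k D(0)` of the wave, `z = x - c t`. -/
def speed (a b k : ℝ) : ℝ := -k * diffusivity a b 0

/-- The lower end `u_l` of the shock. -/
def shockLower (a b : ℝ) : ℝ := (a + b - √(3 * (a - b) ^ 2)) / 2

/-- The upper end `u_r` of the shock. -/
def shockUpper (a b : ℝ) : ℝ := (a + b + √(3 * (a - b) ^ 2)) / 2

/-- The position `z_s` of the shock: `Φ(u_l) = Φ(0) exp (k z_s)`. -/
def shockPos (a b k : ℝ) : ℝ :=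
  Real.log (kirchhoff a b (shockLower a b) / kirchhoff a b 0) / k

/-- The shock-fronted wave `ū`: the solution of `Φ(ū(z)) = c₁ exp (k z)`, `c₁ = Φ(0)` (so that the
front `ū = 0` is at `z = 0`), on the branch `[u_r, 1]` to the left of the shock and on the branch
`[0, u_l]` to the right of it. Only `z < 0` matters. See `wave_left`, `wave_right`. -/
def wave (a b k z : ℝ) : ℝ :=
  if z < shockPos a b k then
    Function.invFunOn (kirchhoff a b) (Icc (shockUpper a b) 1) (kirchhoff a b 0 * Real.exp (k * z))
  else
    Function.invFunOn (kirchhoff a b) (Icc 0 (shockLower a b)) (kirchhoff a b 0 * Real.exp (k * z))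

/-- The slope `ū_z = k Φ(ū) / D(ū)` of the wave as a function of the value `u` of `ū`
(differentiate `Φ(ū) = c₁ exp (k z)`). See `hasDerivAt_wave`. -/
def waveSlope (a b k u : ℝ) : ℝ := k * kirchhoff a b u / diffusivity a b u

/-- `D(ū)_zz` as a function of the value `u` of `ū`: `D(ū)_z = D'(ū) ū_z`, and one more `z`
derivative by the chain rule. See `deriv_deriv_diffusivity_wave`. At the value `u = 1`, which `ū`
only approaches as `z → -∞`, this is the limit. -/
def diffusivityZZ (a b k u : ℝ) : ℝ :=
  deriv (fun w => deriv (diffusivity a b) w * waveSlope a b k w) u * waveSlope a b k u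

/-! ### The linearised operator -/

/-- The Hilbert space `L²((-∞, 0); ℂ)`. -/
abbrev L2Neg : Type := Lp ℂ 2 (volume.restrict (Iio (0 : ℝ)))

/-- On the interval `I`, `F` is locally absolutely continuous with almost everywhere (equivalently,
weak) derivative `G`. -/
def HasACDerivOn (F G : ℝ → ℂ) (I : Set ℝ) : Prop :=
  ∀ x ∈ I, ∀ y ∈ I, IntervalIntegrable G volume x y ∧ F y - F x = ∫ t in x..y, G t

/-- `P` is an admissible perturbation, for a shock at `s`, with derivatives `P₁` and `P₂`: it is
`H²` on `(-∞, s)` and on `(s, 0)`, it is `C¹` on `(-∞, 0)`, in particular across the shock, and it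
vanishes at `0` and at `-∞`. -/
structure IsAdmissible (s : ℝ) (P P₁ P₂ : ℝ → ℂ) : Prop where
  hasDerivAt : ∀ z < 0, HasDerivAt P (P₁ z) z
  continuousOn : ContinuousOn P₁ (Iio 0)
  left : HasACDerivOn P₁ P₂ (Iio s)
  right : HasACDerivOn P₁ P₂ (Ioo s 0)
  memLp : MemLp P 2 (volume.restrict (Iio 0))
  memLp_one : MemLp P₁ 2 (volume.restrict (Iio 0))
  memLp_two : MemLp P₂ 2 (volume.restrict (Iio 0))
  front : Tendsto P (𝓝[<] 0) (𝓝 0)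
  farField : Tendsto P atBot (𝓝 0)

/-- `f = (D(ū) p)_zz + c p_z + R'(ū) p` on `(-∞, 0)`, for an admissible `p`. The second derivative
`Q₁` of `D(ū) p` is taken on each side of the shock. -/
def IsLinearisation (a b k : ℝ) (p f : L2Neg) : Prop :=
  ∃ P P₁ P₂ Q Q₁ : ℝ → ℂ,
    IsAdmissible (shockPos a b k) P P₁ P₂ ∧
    p =ᵐ[volume.restrict (Iio 0)] P ∧
    (∀ z < 0, z ≠ shockPos a b k →
      HasDerivAt (fun y => (diffusivity a b (wave a b k y) : ℂ) * P y) (Q z) z) ∧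
    HasACDerivOn Q Q₁ (Iio (shockPos a b k)) ∧
    HasACDerivOn Q Q₁ (Ioo (shockPos a b k) 0) ∧
    f =ᵐ[volume.restrict (Iio 0)] fun z =>
      Q₁ z + (speed a b k : ℂ) * P₁ z + ((deriv (reaction a b k) (wave a b k z) : ℝ) : ℂ) * P z

theorem HasACDerivOn.add {F G F' G' : ℝ → ℂ} {I : Set ℝ} (h : HasACDerivOn F G I)
    (h' : HasACDerivOn F' G' I) : HasACDerivOn (F + F') (G + G') I := by
  intro x hx y hy
  obtain ⟨h1, h2⟩ := h x hx y hy
  obtain ⟨h3, h4⟩ := h' x hx y hy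
  refine ⟨h1.add h3, ?_⟩
  simp only [Pi.add_apply]
  rw [intervalIntegral.integral_add h1 h3, ← h2, ← h4]
  ring

theorem HasACDerivOn.smul {F G : ℝ → ℂ} {I : Set ℝ} (c : ℂ) (h : HasACDerivOn F G I) :
    HasACDerivOn (c • F) (c • G) I := by
  intro x hx y hy
  obtain ⟨h1, h2⟩ := h x hx y hy
  refine ⟨h1.smul c, ?_⟩
  simp only [Pi.smul_apply]
  rw [intervalIntegral.integral_smul, ← h2, smul_sub]

theorem IsLinearisation.add {a b k : ℝ} {p f p' f' : L2Neg} (h : IsLinearisation a b k p f)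
    (h' : IsLinearisation a b k p' f') : IsLinearisation a b k (p + p') (f + f') := by
  obtain ⟨P, P₁, P₂, Q, Q₁, hP, hp, hQ, hl, hr, hf⟩ := h
  obtain ⟨P', P₁', P₂', Q', Q₁', hP', hp', hQ', hl', hr', hf'⟩ := h'
  refine ⟨P + P', P₁ + P₁', P₂ + P₂', Q + Q', Q₁ + Q₁',
    ⟨fun z hz => (hP.hasDerivAt z hz).add (hP'.hasDerivAt z hz),
      hP.continuousOn.add hP'.continuousOn, hP.left.add hP'.left, hP.right.add hP'.right,
      hP.memLp.add hP'.memLp, hP.memLp_one.add hP'.memLp_one, hP.memLp_two.add hP'.memLp_two,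
      (add_zero (0 : ℂ)) ▸ hP.front.add hP'.front,
      (add_zero (0 : ℂ)) ▸ hP.farField.add hP'.farField⟩,
    ?_, ?_, hl.add hl', hr.add hr', ?_⟩
  · filter_upwards [hp, hp', Lp.coeFn_add p p'] with z h1 h2 h3
    rw [h3, Pi.add_apply, h1, h2, Pi.add_apply]
  · intro z hz hzs
    convert! (hQ z hz hzs).add (hQ' z hz hzs) using 1
    funext y
    simp [mul_add]
  · filter_upwards [hf, hf', Lp.coeFn_add f f'] with z h1 h2 h3
    rw [h3, Pi.add_apply, h1, h2]
    simp only [Pi.add_apply]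
    ring

theorem IsLinearisation.smul {a b k : ℝ} {p f : L2Neg} (c : ℂ) (h : IsLinearisation a b k p f) :
    IsLinearisation a b k (c • p) (c • f) := by
  obtain ⟨P, P₁, P₂, Q, Q₁, hP, hp, hQ, hl, hr, hf⟩ := h
  refine ⟨c • P, c • P₁, c • P₂, c • Q, c • Q₁,
    ⟨fun z hz => (hP.hasDerivAt z hz).const_smul c,
      hP.continuousOn.const_smul c, hP.left.smul c, hP.right.smul c,
      hP.memLp.const_smul c, hP.memLp_one.const_smul c, hP.memLp_two.const_smul c,
      (smul_zero c : c • (0 : ℂ) = 0) ▸ hP.front.const_smul c,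
      (smul_zero c : c • (0 : ℂ) = 0) ▸ hP.farField.const_smul c⟩,
    ?_, ?_, hl.smul c, hr.smul c, ?_⟩
  · filter_upwards [hp, Lp.coeFn_smul c p] with z h1 h3
    rw [h3, Pi.smul_apply, h1, Pi.smul_apply]
  · intro z hz hzs
    convert! (hQ z hz hzs).const_smul c using 1
    funext y
    simp [mul_left_comm]
  · filter_upwards [hf, Lp.coeFn_smul c f] with z h1 h3
    rw [h3, Pi.smul_apply, h1]
    simp only [Pi.smul_apply, smul_eq_mul]
    ring

theorem IsLinearisation.zero (a b k : ℝ) : IsLinearisation a b k 0 0 := by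
  have hz' : ∀ I, HasACDerivOn (0 : ℝ → ℂ) 0 I := fun I x _ y _ =>
    ⟨intervalIntegrable_const (c := (0 : ℂ)), by simp⟩
  refine ⟨0, 0, 0, 0, 0, ⟨fun z _ => hasDerivAt_const z 0, continuousOn_const, hz' _, hz' _,
    MemLp.zero, MemLp.zero, MemLp.zero, tendsto_const_nhds, tendsto_const_nhds⟩,
    Lp.coeFn_zero _ _ _, ?_, hz' _, hz' _, ?_⟩
  · intro z _ _
    simpa using hasDerivAt_const z (0 : ℂ)
  · filter_upwards [Lp.coeFn_zero ℂ 2 (volume.restrict (Iio (0 : ℝ)))] with z h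
    simpa using h

/-- The graph of the linearised operator. -/
def linearisedGraph (a b k : ℝ) : Submodule ℂ (L2Neg × L2Neg) where
  carrier := {x | IsLinearisation a b k x.1 x.2}
  add_mem' := fun h h' => h.add h'
  zero_mem' := IsLinearisation.zero a b k
  smul_mem' := fun c _ h => h.smul c

/-- The linearised operator `𝓛(ū) p = (D(ū) p)_zz + c p_z + R'(ū) p` in `L²((-∞, 0))`, an unbounded
operator whose domain is the set of admissible perturbations. See `mem_graph_linearisedOperator`. -/
def linearisedOperator (a b k : ℝ) : L2Neg →ₗ.[ℂ] L2Neg := (linearisedGraph a b k).toLinearPMap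

/-! ### Spectral stability -/

/-- The spectrum of an unbounded operator `T`: the `μ` for which `T - μ` has no bounded inverse. -/
def spectrumOp {E : Type*} [NormedAddCommGroup E] [NormedSpace ℂ E] (T : E →ₗ.[ℂ] E) : Set ℂ :=
  {μ | ¬ ∃ B : E →L[ℂ] E,
    (∀ f : E, ∃ h : B f ∈ T.domain, T ⟨B f, h⟩ - μ • B f = f) ∧
    ∀ p : T.domain, B (T p - μ • (p : E)) = p}

/-- Spectral stability: the spectrum lies in the open left half plane. -/
def SpectrallyStable {E : Type*} [NormedAddCommGroup E] [NormedSpace ℂ E]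
    (T : E →ₗ.[ℂ] E) : Prop :=
  ∀ μ ∈ spectrumOp T, μ.re < 0

/-! ### The definitions mean what they should -/

theorem HasACDerivOn.ae_eq_zero {F G : ℝ → ℂ} {I : Set ℝ} (hI : IsOpen I)
    (h : HasACDerivOn F G I) (hF : ∀ x ∈ I, F x = 0) : ∀ᵐ x, x ∈ I → G x = 0 := by
  have key : ∀ᵐ x, ∀ q r : ℚ, (q : ℝ) ∈ I → (r : ℝ) ∈ I → x ∈ uIcc (q : ℝ) r →
      ∀ c ∈ uIcc (q : ℝ) r, HasDerivAt (fun x => ∫ t in c..x, G t) (G x) x := by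
    rw [ae_all_iff]; intro q
    rw [ae_all_iff]; intro r
    by_cases hq : (q : ℝ) ∈ I
    · by_cases hr : (r : ℝ) ∈ I
      · filter_upwards [(h q hq r hr).1.ae_hasDerivAt_integral] with x hx _ _ using hx
      · exact Eventually.of_forall fun x _ hr' => absurd hr' hr
    · exact Eventually.of_forall fun x hq' => absurd hq' hq
  filter_upwards [key] with x hx hxI
  obtain ⟨ε, hε, hball⟩ := Metric.isOpen_iff.1 hI x hxI
  rw [Real.ball_eq_Ioo] at hball
  obtain ⟨q, hq1, hq2⟩ := exists_rat_btwn (show x - ε < x by linarith)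
  obtain ⟨r, hr1, hr2⟩ := exists_rat_btwn (show x < x + ε by linarith)
  have hq : (q : ℝ) ∈ I := hball ⟨hq1, by linarith⟩
  have hr : (r : ℝ) ∈ I := hball ⟨by linarith, hr2⟩
  have hu : uIcc (q : ℝ) r = Icc (q : ℝ) r := uIcc_of_le (by linarith)
  have hd := hx q r hq hr (by rw [hu]; exact ⟨hq2.le, hr1.le⟩) q (by simp)
  have hev : (fun x => ∫ t in (q : ℝ)..x, G t) =ᶠ[𝓝 x] fun _ => 0 := by
    filter_upwards [hI.mem_nhds hxI] with y hy
    rw [← (h q hq y hy).2, hF y hy, hF q hq, sub_zero]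
  exact hd.unique ((hasDerivAt_const x (0 : ℂ)).congr_of_eventuallyEq hev)

theorem linearisedGraph_functional (a b k : ℝ) (x : L2Neg × L2Neg)
    (hx : x ∈ linearisedGraph a b k) (hx0 : x.1 = 0) : x.2 = 0 := by
  obtain ⟨p, f⟩ := x
  obtain ⟨P, P₁, P₂, Q, Q₁, hP, hp, hQ, hl, hr, hf⟩ := hx
  simp only at hx0 hp hf ⊢
  subst hx0
  set s := shockPos a b k
  have hP0 : EqOn P 0 (Iio 0) := by
    refine Measure.eqOn_open_of_ae_eq (μ := volume) ?_ isOpen_Iio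
      (fun z hz => (hP.hasDerivAt z hz).continuousAt.continuousWithinAt) continuousOn_const
    filter_upwards [hp, Lp.coeFn_zero ℂ 2 (volume.restrict (Iio (0 : ℝ)))] with z h1 h2
    rw [← h1, h2]
  have hP1 : ∀ z < 0, P₁ z = 0 := fun z hz =>
    (hP.hasDerivAt z hz).unique ((hasDerivAt_const z (0 : ℂ)).congr_of_eventuallyEq
      (by filter_upwards [isOpen_Iio.mem_nhds hz] with y hy using hP0 hy))
  have hQ0 : ∀ z < 0, z ≠ s → Q z = 0 := fun z hz hzs =>
    (hQ z hz hzs).unique ((hasDerivAt_const z (0 : ℂ)).congr_of_eventuallyEq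
      (by filter_upwards [isOpen_Iio.mem_nhds hz] with y hy; simp [hP0 hy]))
  have hl' : HasACDerivOn Q Q₁ (Iio (min s 0)) := fun x hx y hy =>
    hl x (Iio_subset_Iio (min_le_left _ _) hx) y (Iio_subset_Iio (min_le_left _ _) hy)
  have h1 := hl'.ae_eq_zero isOpen_Iio fun z hz =>
    hQ0 z (lt_of_lt_of_le hz (min_le_right _ _)) (lt_of_lt_of_le hz (min_le_left _ _)).ne
  have h2 := hr.ae_eq_zero isOpen_Ioo fun z hz => hQ0 z hz.2 hz.1.ne'
  have h3 : ∀ᵐ z : ℝ, z ≠ s := by simp [ae_iff, measure_singleton]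
  rw [Lp.eq_zero_iff_ae_eq_zero]
  filter_upwards [hf, ae_restrict_of_ae h1, ae_restrict_of_ae h2, ae_restrict_of_ae h3,
    ae_restrict_mem measurableSet_Iio] with z e e1 e2 e3 hz
  have hz' : z < 0 := hz
  have : Q₁ z = 0 := by
    rcases lt_or_gt_of_ne e3 with h | h
    · exact e1 (lt_min h hz')
    · exact e2 ⟨h, hz'⟩
  rw [e, this, hP1 z hz', hP0 hz]
  simp

/-- `𝓛(ū) p = f` means exactly that `p` is admissible and `f = (D(ū) p)_zz + c p_z + R'(ū) p`. -/
theorem mem_graph_linearisedOperator (a b k : ℝ) (p f : L2Neg) :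
    (p, f) ∈ (linearisedOperator a b k).graph ↔ IsLinearisation a b k p f := by
  rw [linearisedOperator, Submodule.toLinearPMap_graph_eq _ (linearisedGraph_functional a b k)]
  rfl

theorem hasDerivAt_diffusivity (a b u : ℝ) :
    HasDerivAt (diffusivity a b) (2 * u - a - b) u := by
  have := ((hasDerivAt_id u).sub_const a).mul ((hasDerivAt_id u).sub_const b)
  convert! this using 1
  simp; ring

theorem continuous_diffusivity (a b : ℝ) : Continuous (diffusivity a b) := by
  unfold diffusivity; fun_prop

theorem hasDerivAt_kirchhoff (a b u : ℝ) :
    HasDerivAt (kirchhoff a b) (diffusivity a b u) u :=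
  intervalIntegral.integral_hasDerivAt_right
    ((continuous_diffusivity a b).intervalIntegrable _ _)
    ((continuous_diffusivity a b).stronglyMeasurableAtFilter _ _)
    (continuous_diffusivity a b).continuousAt

theorem kirchhoff_eq (a b u : ℝ) : kirchhoff a b u =
    1 / 6 * (u - 1) * (2 * u ^ 2 + (2 - 3 * a - 3 * b) * u + 2 - 3 * a - 3 * b + 6 * a * b) := by
  have h : ∀ x ∈ uIcc 1 u, HasDerivAt (fun u : ℝ => 1 / 6 * (u - 1) *
      (2 * u ^ 2 + (2 - 3 * a - 3 * b) * u + 2 - 3 * a - 3 * b + 6 * a * b))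
      (diffusivity a b x) x := by
    intro x _
    have h1 : HasDerivAt (fun u : ℝ => 1 / 6 * (u - 1)) (1 / 6) x := by
      simpa using ((hasDerivAt_id x).sub_const 1).const_mul (1 / 6 : ℝ)
    have h2 : HasDerivAt (fun u : ℝ => 2 * u ^ 2 + (2 - 3 * a - 3 * b) * u + 2 - 3 * a - 3 * b +
        6 * a * b) (4 * x + (2 - 3 * a - 3 * b)) x := by
      have h3 := ((((((hasDerivAt_pow 2 x).const_mul 2).add ((hasDerivAt_id x).const_mul
        (2 - 3 * a - 3 * b))).add_const 2).sub_const (3 * a)).sub_const (3 * b)).add_const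
        (6 * a * b)
      convert! h3 using 1
      norm_num; ring
    convert! h1.mul h2 using 1
    simp only [diffusivity]
    ring
  rw [kirchhoff, intervalIntegral.integral_eq_sub_of_hasDerivAt h
    ((continuous_diffusivity a b).intervalIntegrable _ _)]
  ring

/-- The shock is the one that is fixed by continuity of `Φ` and of `Φ' = D`. -/
theorem shock_iff {a b : ℝ} (hab : a < b) (l r : ℝ) :
    (l < r ∧ kirchhoff a b l = kirchhoff a b r ∧ diffusivity a b l = diffusivity a b r) ↔
      l = shockLower a b ∧ r = shockUpper a b := by
  have hs : √(3 * (a - b) ^ 2) ^ 2 = 3 * (a - b) ^ 2 := Real.sq_sqrt (by positivity)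
  have hs0 : 0 < √(3 * (a - b) ^ 2) := Real.sqrt_pos.2 (by have := sq_pos_of_neg (sub_neg.2 hab); positivity)
  simp only [kirchhoff_eq, diffusivity, shockLower, shockUpper]
  set s := √(3 * (a - b) ^ 2)
  constructor
  · rintro ⟨hlr, h1, h2⟩
    have hne : l - r ≠ 0 := (sub_neg.2 hlr).ne
    have hr : l + r = a + b := by
      apply mul_left_cancel₀ hne
      linear_combination h2
    have hl : r = a + b - l := by linarith
    have h3 : (r - l) ^ 2 = s ^ 2 := by
      apply mul_left_cancel₀ hne
      rw [hs]
      subst hl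
      linear_combination 12 * h1
    have h4 : r - l = s := by
      rcases sq_eq_sq_iff_eq_or_eq_neg.1 h3 with h | h <;> linarith
    constructor <;> linarith
  · rintro ⟨rfl, rfl⟩
    refine ⟨by linarith, ?_, by ring⟩
    linear_combination (-s / 12) * hs

theorem sqrt_shock {a b : ℝ} (hab : a < b) : √(3 * (a - b) ^ 2) = √3 * (b - a) := by
  rw [Real.sqrt_mul (by norm_num), Real.sqrt_sq_eq_abs, abs_of_neg (by linarith), neg_sub]

theorem strictMonoOn_kirchhoff_right {a b : ℝ} (hab : a < b) :
    StrictMonoOn (kirchhoff a b) (Ici b) := by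
  refine strictMonoOn_of_deriv_pos (convex_Ici b)
    (fun u _ => (hasDerivAt_kirchhoff a b u).continuousAt.continuousWithinAt) fun u hu => ?_
  rw [interior_Ici] at hu
  rw [(hasDerivAt_kirchhoff a b u).deriv]
  exact mul_pos (sub_pos.2 (hab.trans hu)) (sub_pos.2 hu)

theorem strictMonoOn_kirchhoff_left {a b : ℝ} (hab : a < b) :
    StrictMonoOn (kirchhoff a b) (Iic a) := by
  refine strictMonoOn_of_deriv_pos (convex_Iic a)
    (fun u _ => (hasDerivAt_kirchhoff a b u).continuousAt.continuousWithinAt) fun u hu => ?_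
  rw [interior_Iic] at hu
  rw [(hasDerivAt_kirchhoff a b u).deriv]
  exact mul_pos_of_neg_of_neg (sub_neg.2 hu) (sub_neg.2 (lt_trans hu hab))

theorem shock_bounds {a b : ℝ} (hab : a < b) (hneg : b < (a + 2) / 3) (hpos : b < a * (2 + √3)) :
    0 < shockLower a b ∧ shockLower a b < a ∧ b < shockUpper a b ∧ shockUpper a b < 1 ∧
      kirchhoff a b 0 < kirchhoff a b (shockLower a b) ∧
      kirchhoff a b (shockLower a b) < 0 := by
  have ht : √3 ^ 2 = 3 := Real.sq_sqrt (by norm_num)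
  have ht1 : 1 < √3 := Real.lt_sqrt_of_sq_lt (by norm_num)
  have h0 : 0 < shockLower a b := by
    rw [shockLower, sqrt_shock hab]
    nlinarith [mul_pos (sub_pos.2 ht1) (sub_pos.2 hpos)]
  have hl : shockLower a b < a := by
    rw [shockLower, sqrt_shock hab]
    nlinarith [mul_pos (sub_pos.2 ht1) (sub_pos.2 hab)]
  have hr : b < shockUpper a b := by
    rw [shockUpper, sqrt_shock hab]
    nlinarith [mul_pos (sub_pos.2 ht1) (sub_pos.2 hab)]
  have hm := strictMonoOn_kirchhoff_left hab
  have h1 : kirchhoff a b 0 < kirchhoff a b (shockLower a b) :=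
    hm (by simp only [mem_Iic]; linarith) hl.le h0
  have h2 : kirchhoff a b (shockLower a b) < kirchhoff a b a := hm hl.le (mem_Iic.2 le_rfl) hl
  have h3 : kirchhoff a b a < 0 := by
    have : kirchhoff a b a = -(1 / 6 * ((1 - a) ^ 2 * (a + 2 - 3 * b))) := by
      rw [kirchhoff_eq]; ring
    rw [this]
    have : 0 < (1 - a) ^ 2 * (a + 2 - 3 * b) := mul_pos (pow_pos (by linarith) 2) (by linarith)
    linarith
  refine ⟨h0, hl, hr, ?_, h1, h2.trans h3⟩
  by_contra! h
  have h4 := (strictMonoOn_kirchhoff_right hab).monotoneOn (mem_Ici.2 (by linarith)) hr.le h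
  have h5 := ((shock_iff hab _ _).2 ⟨rfl, rfl⟩).2.1
  have h6 : kirchhoff a b 1 = 0 := by simp [kirchhoff]
  linarith

/-- `Φ(u_l) = c₁ exp (k z_s)`, and the shock is behind the front. -/
theorem shockPos_spec {a b k : ℝ} (hab : a < b) (hneg : b < (a + 2) / 3)
    (hpos : b < a * (2 + √3)) (hk : 0 < k) :
    shockPos a b k < 0 ∧
      kirchhoff a b 0 * Real.exp (k * shockPos a b k) = kirchhoff a b (shockLower a b) := by
  obtain ⟨-, -, -, -, h1, h2⟩ := shock_bounds hab hneg hpos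
  have h3 : kirchhoff a b 0 < 0 := h1.trans h2
  constructor
  · exact div_neg_of_neg_of_pos (Real.log_neg (div_pos_of_neg_of_neg h2 h3)
      ((div_lt_one_of_neg h3).2 h1)) hk
  · rw [shockPos, mul_div_cancel₀ _ hk.ne', Real.exp_log (div_pos_of_neg_of_neg h2 h3),
      mul_div_cancel₀ _ h3.ne]

/-- To the left of the shock, `ū` is the solution with values in `(u_r, 1)`. -/
theorem wave_left {a b k z : ℝ} (hab : a < b) (hneg : b < (a + 2) / 3)
    (hpos : b < a * (2 + √3)) (hk : 0 < k) (hz : z < shockPos a b k) :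
    wave a b k z ∈ Ioo (shockUpper a b) 1 ∧
      kirchhoff a b (wave a b k z) = kirchhoff a b 0 * Real.exp (k * z) := by
  obtain ⟨h0, hl, hr, hr1, h1, h2⟩ := shock_bounds hab hneg hpos
  obtain ⟨hs, hs'⟩ := shockPos_spec hab hneg hpos hk
  have h3 : kirchhoff a b 0 < 0 := h1.trans h2
  have h5 := ((shock_iff hab _ _).2 ⟨rfl, rfl⟩).2.1
  have h6 : kirchhoff a b 1 = 0 := by simp [kirchhoff]
  have hmem : kirchhoff a b 0 * Real.exp (k * z) ∈
      Icc (kirchhoff a b (shockUpper a b)) (kirchhoff a b 1) := by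
    rw [h6, ← h5, ← hs']
    refine ⟨mul_le_mul_of_nonpos_left (Real.exp_le_exp.2 ?_) h3.le,
      mul_nonpos_of_nonpos_of_nonneg h3.le (Real.exp_pos _).le⟩
    exact mul_le_mul_of_nonneg_left hz.le hk.le
  have hex := intermediate_value_Icc hr1.le
    (fun u _ => (hasDerivAt_kirchhoff a b u).continuousAt.continuousWithinAt) hmem
  rw [wave, if_pos hz]
  obtain ⟨hm, he⟩ := Function.invFunOn_pos hex
  refine ⟨⟨lt_of_le_of_ne hm.1 fun h => ?_, lt_of_le_of_ne hm.2 fun h => ?_⟩, he⟩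
  · rw [← h, ← h5, ← hs'] at he
    have := Real.exp_injective (mul_left_cancel₀ h3.ne he)
    exact hz.ne' (mul_left_cancel₀ hk.ne' this)
  · rw [h, h6] at he
    exact (mul_neg_of_neg_of_pos h3 (Real.exp_pos (k * z))).ne he.symm

/-- Between the shock and the front, `ū` is the solution with values in `[0, u_l]`. -/
theorem wave_right {a b k z : ℝ} (hab : a < b) (hneg : b < (a + 2) / 3)
    (hpos : b < a * (2 + √3)) (hk : 0 < k) (hz : shockPos a b k < z) (hz0 : z < 0) :
    wave a b k z ∈ Ioo 0 (shockLower a b) ∧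
      kirchhoff a b (wave a b k z) = kirchhoff a b 0 * Real.exp (k * z) := by
  obtain ⟨h0, hl, hr, hr1, h1, h2⟩ := shock_bounds hab hneg hpos
  obtain ⟨hs, hs'⟩ := shockPos_spec hab hneg hpos hk
  have h3 : kirchhoff a b 0 < 0 := h1.trans h2
  have hmem : kirchhoff a b 0 * Real.exp (k * z) ∈
      Icc (kirchhoff a b 0) (kirchhoff a b (shockLower a b)) := by
    rw [← hs']
    constructor
    · nlinarith [Real.exp_le_one_iff.2 (mul_nonpos_of_nonneg_of_nonpos hk.le hz0.le)]
    · exact mul_le_mul_of_nonpos_left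
        (Real.exp_le_exp.2 (mul_le_mul_of_nonneg_left hz.le hk.le)) h3.le
  have hex := intermediate_value_Icc h0.le
    (fun u _ => (hasDerivAt_kirchhoff a b u).continuousAt.continuousWithinAt) hmem
  rw [wave, if_neg hz.not_gt]
  obtain ⟨hm, he⟩ := Function.invFunOn_pos hex
  refine ⟨⟨lt_of_le_of_ne hm.1 fun h => ?_, lt_of_le_of_ne hm.2 fun h => ?_⟩, he⟩
  · rw [← h] at he
    have h7 : Real.exp (k * z) = 1 := mul_left_cancel₀ h3.ne (by linarith)
    rw [Real.exp_eq_one_iff] at h7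
    exact (mul_neg_of_pos_of_neg hk hz0).ne h7
  · rw [h, ← hs'] at he
    have := Real.exp_injective (mul_left_cancel₀ h3.ne he)
    exact hz.ne (mul_left_cancel₀ hk.ne' this)

theorem hasDerivAt_wave {a b k z : ℝ} (hab : a < b) (hneg : b < (a + 2) / 3)
    (hpos : b < a * (2 + √3)) (hk : 0 < k) (hz0 : z < 0) (hzs : z ≠ shockPos a b k) :
    HasDerivAt (wave a b k) (waveSlope a b k (wave a b k z)) z ∧
      0 < diffusivity a b (wave a b k z) := by
  obtain ⟨h0, hl, hr, hr1, h1, h2⟩ := shock_bounds hab hneg hpos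
  -- the branch that contains the value of the wave
  obtain ⟨I, hIo, hz, hinj, hev⟩ : ∃ I : Set ℝ, IsOpen I ∧ wave a b k z ∈ I ∧
      (∀ u ∈ I, ∀ v ∈ I, kirchhoff a b u = kirchhoff a b v → u = v) ∧
      (∀ᶠ y in 𝓝 z, wave a b k y ∈ I ∧
        kirchhoff a b (wave a b k y) = kirchhoff a b 0 * Real.exp (k * y)) ∧
      ∀ u ∈ I, 0 < diffusivity a b u := by
    rcases lt_or_gt_of_ne hzs with h | h
    · refine ⟨Ioo (shockUpper a b) 1, isOpen_Ioo, (wave_left hab hneg hpos hk h).1, ?_, ?_, ?_⟩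
      · intro u hu v hv
        exact (strictMonoOn_kirchhoff_right hab).injOn (hr.trans hu.1).le (hr.trans hv.1).le
      · filter_upwards [isOpen_Iio.mem_nhds h] with y hy using wave_left hab hneg hpos hk hy
      · intro u hu
        exact mul_pos (by linarith [hu.1]) (by linarith [hu.1])
    · refine ⟨Ioo 0 (shockLower a b), isOpen_Ioo, (wave_right hab hneg hpos hk h hz0).1, ?_, ?_, ?_⟩
      · intro u hu v hv
        exact (strictMonoOn_kirchhoff_left hab).injOn (hu.2.trans hl).le (hv.2.trans hl).le
      · filter_upwards [isOpen_Ioo.mem_nhds (show z ∈ Ioo (shockPos a b k) 0 from ⟨h, hz0⟩)] with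
          y hy using wave_right hab hneg hpos hk hy.1 hy.2
      · intro u hu
        exact mul_pos_of_neg_of_neg (by linarith [hu.2]) (by linarith [hu.2])
  obtain ⟨hev, hD⟩ := hev
  have hDz := hD _ hz
  refine ⟨?_, hDz⟩
  have hΦz := hev.self_of_nhds.2
  have hcd : ContDiff ℝ 1 (kirchhoff a b) := by
    have : kirchhoff a b = fun u => 1 / 6 * (u - 1) *
        (2 * u ^ 2 + (2 - 3 * a - 3 * b) * u + 2 - 3 * a - 3 * b + 6 * a * b) :=
      funext (kirchhoff_eq a b)
    rw [this]; fun_prop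
  have hst : HasStrictDerivAt (kirchhoff a b) (diffusivity a b (wave a b k z)) (wave a b k z) :=
    hcd.contDiffAt.hasStrictDerivAt' (hasDerivAt_kirchhoff a b _) (by norm_num)
  have hg := hst.to_localInverse hDz.ne'
  set g := hst.localInverse _ _ _ hDz.ne' with hgdef
  have hgz : g (kirchhoff a b (wave a b k z)) = wave a b k z :=
    (hst.hasStrictFDerivAt_equiv hDz.ne').localInverse_apply_image
  have hgr : ∀ᶠ y in 𝓝 (kirchhoff a b (wave a b k z)), kirchhoff a b (g y) = y :=
    (hst.hasStrictFDerivAt_equiv hDz.ne').eventually_right_inverse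
  have hgI : ∀ᶠ y in 𝓝 (kirchhoff a b (wave a b k z)), g y ∈ I :=
    hg.hasDerivAt.continuousAt.eventually (by rw [hgz]; exact hIo.mem_nhds hz)
  have hexp : HasDerivAt (fun y => kirchhoff a b 0 * Real.exp (k * y))
      (k * kirchhoff a b (wave a b k z)) z := by
    have := (((hasDerivAt_id z).const_mul k).exp).const_mul (kirchhoff a b 0)
    convert! this using 1
    rw [hΦz]; simp; ring
  have hcont := hexp.continuousAt.tendsto
  simp only [← hΦz] at hcont
  have hcomp := HasDerivAt.comp z (h₂ := g) (by rw [← hΦz]; exact hg.hasDerivAt) hexp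
  have heq : wave a b k =ᶠ[𝓝 z] g ∘ fun y => kirchhoff a b 0 * Real.exp (k * y) := by
    filter_upwards [hev, hcont.eventually hgr, hcont.eventually hgI] with y e1 e2 e3
    exact hinj _ e1.1 _ e3 (by rw [e1.2]; exact e2.symm)
  refine (hcomp.congr_of_eventuallyEq heq).congr_deriv ?_
  rw [waveSlope]; field_simp

/-- The `z` derivative of `D(ū)` of order two is `diffusivityZZ` at the value of `ū`. -/
theorem deriv_deriv_diffusivity_wave {a b k z : ℝ} (hab : a < b) (hneg : b < (a + 2) / 3)
    (hpos : b < a * (2 + √3)) (hk : 0 < k) (hz0 : z < 0) (hzs : z ≠ shockPos a b k) :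
    deriv (deriv fun y => diffusivity a b (wave a b k y)) z =
      diffusivityZZ a b k (wave a b k z) := by
  have h1 : ∀ᶠ y in 𝓝 z, deriv (fun y => diffusivity a b (wave a b k y)) y =
      deriv (diffusivity a b) (wave a b k y) * waveSlope a b k (wave a b k y) := by
    filter_upwards [isOpen_Iio.mem_nhds hz0, isOpen_ne.mem_nhds hzs] with y hy hys
    have hw := (hasDerivAt_wave hab hneg hpos hk hy hys).1
    rw [(hasDerivAt_diffusivity a b _).deriv]
    exact ((hasDerivAt_diffusivity a b _).comp y hw).deriv
  rw [EventuallyEq.deriv_eq h1]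
  obtain ⟨hw, hD⟩ := hasDerivAt_wave hab hneg hpos hk hz0 hzs
  have hd : DifferentiableAt ℝ (fun w => deriv (diffusivity a b) w * waveSlope a b k w)
      (wave a b k z) := by
    have : deriv (diffusivity a b) = fun u => 2 * u - a - b :=
      funext fun u => (hasDerivAt_diffusivity a b u).deriv
    rw [this]
    unfold waveSlope
    exact DifferentiableAt.mul (by fun_prop)
      (((hasDerivAt_kirchhoff a b _).differentiableAt.const_mul k).div
        (hasDerivAt_diffusivity a b _).differentiableAt hD.ne')
  exact (hd.hasDerivAt.comp z hw).deriv

end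

end RecedingWave

/-!
An element `p` of the domain vanishes at `0`, so it is determined by `q = p' - p`, and `q ↦ p` is an
isomorphism of `L²` onto `H¹₀` given by an exponential kernel; its adjoint inverts `w' = -w - h`.
Since `p` is `C¹` across the shock and `D(ū)` is continuous there, so is the flux `D(ū) p'`, and
`𝓛(ū) p - μ p = f` is a first-order system for `p` and the flux in which the kink of `D(ū)` is
harmless. In weak form it is an equation for `q` in `L²` whose sesquilinear form is coercive for
`Re μ ≥ 0`: integrating the drift term `(D(ū)_z + c) Re (p̄ p')` by parts leaves the potential
`½ D(ū)_zz + R'(ū)`, negative by assumption, and a contribution from the shock whose sign is good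
because `D(ū)_z` jumps upwards there. The Lax–Milgram theorem then yields a bounded resolvent.
-/

namespace RecedingWave

noncomputable section

open scoped ENNReal InnerProductSpace

/-! ### The Schur test -/

/-- A nonnegative kernel all of whose row and column integrals are at most one. By the Schur test
it defines a contraction of `L²`. -/
structure IsSubstochastic {α β : Type*} [MeasurableSpace α] [MeasurableSpace β] (μ : Measure α)
    (ν : Measure β) (κ : α → β → ℝ) : Prop where
  measurable : Measurable (Function.uncurry κ)
  nonneg : ∀ x y, 0 ≤ κ x y
  row : ∀ x, ∫⁻ y, ENNReal.ofReal (κ x y) ∂ν ≤ 1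
  col : ∀ y, ∫⁻ x, ENNReal.ofReal (κ x y) ∂μ ≤ 1

theorem lintegral_sq_enorm_lt_top {α E : Type*} [MeasurableSpace α] {μ : Measure α}
    [NormedAddCommGroup E] {q : α → E} (hq : MemLp q 2 μ) : ∫⁻ y, ‖q y‖ₑ ^ 2 ∂μ < ∞ := by
  simpa using lintegral_rpow_enorm_lt_top_of_eLpNorm_lt_top two_ne_zero ENNReal.ofNat_ne_top hq.2

namespace IsSubstochastic

variable {α β E 𝕜 : Type*} [MeasurableSpace α] [MeasurableSpace β] {μ : Measure α} {ν : Measure β}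
  {κ : α → β → ℝ} [NormedAddCommGroup E] [NormedSpace ℝ E] [RCLike 𝕜]

theorem swap (h : IsSubstochastic μ ν κ) : IsSubstochastic ν μ (fun y x => κ x y) :=
  ⟨h.measurable.comp measurable_swap, fun y x => h.nonneg x y, h.col, h.row⟩

theorem measurable_row (h : IsSubstochastic μ ν κ) (x : α) : Measurable (κ x) :=
  h.measurable.comp measurable_prodMk_left

theorem lintegral_mul_sq_le (h : IsSubstochastic μ ν κ) {φ : β → ℝ≥0∞} (hφ : AEMeasurable φ ν)
    (x : α) : (∫⁻ y, ENNReal.ofReal (κ x y) * φ y ∂ν) ^ 2 ≤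
      ∫⁻ y, ENNReal.ofReal (κ x y) * φ y ^ 2 ∂ν := by
  have hm : AEMeasurable (fun y => ENNReal.ofReal (κ x y)) ν :=
    (h.measurable_row x).ennreal_ofReal.aemeasurable
  have hsplit : ∀ y, ENNReal.ofReal (κ x y) ^ (1 / 2 : ℝ) *
      (ENNReal.ofReal (κ x y) * φ y ^ 2) ^ (1 / 2 : ℝ) = ENNReal.ofReal (κ x y) * φ y := by
    intro y
    rw [ENNReal.mul_rpow_of_nonneg _ _ (by norm_num), ← mul_assoc,
      ← ENNReal.rpow_add_of_nonneg _ _ (by norm_num) (by norm_num), ← ENNReal.rpow_natCast,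
      ← ENNReal.rpow_mul]
    norm_num
  have holder := ENNReal.lintegral_mul_norm_pow_le (μ := ν) (p := 1 / 2) (q := 1 / 2)
    hm (hm.mul (hφ.pow_const 2)) (by norm_num) (by norm_num) (by norm_num)
  simp only [Pi.mul_apply, hsplit] at holder
  calc (∫⁻ y, ENNReal.ofReal (κ x y) * φ y ∂ν) ^ 2
      ≤ ((∫⁻ y, ENNReal.ofReal (κ x y) ∂ν) ^ (1 / 2 : ℝ) *
        (∫⁻ y, ENNReal.ofReal (κ x y) * φ y ^ 2 ∂ν) ^ (1 / 2 : ℝ)) ^ 2 := by gcongr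
    _ ≤ (1 * (∫⁻ y, ENNReal.ofReal (κ x y) * φ y ^ 2 ∂ν) ^ (1 / 2 : ℝ)) ^ 2 := by
        gcongr
        exact ENNReal.rpow_le_one (h.row x) (by norm_num)
    _ = _ := by
        rw [one_mul, ← ENNReal.rpow_natCast, ← ENNReal.rpow_mul]
        norm_num

theorem lintegral_lintegral_mul_le [SFinite μ] [SFinite ν] (h : IsSubstochastic μ ν κ)
    {φ : β → ℝ≥0∞} (hφ : AEMeasurable φ ν) :
    ∫⁻ x, ∫⁻ y, ENNReal.ofReal (κ x y) * φ y ∂ν ∂μ ≤ ∫⁻ y, φ y ∂ν := by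
  rw [lintegral_lintegral_swap (h.measurable.ennreal_ofReal.aemeasurable.mul hφ.comp_snd)]
  refine lintegral_mono fun y => ?_
  rw [lintegral_mul_const _ (h.swap.measurable_row y).ennreal_ofReal]
  exact mul_le_of_le_one_left zero_le (h.col y)

theorem lintegral_sq_lintegral_mul_le [SFinite μ] [SFinite ν] (h : IsSubstochastic μ ν κ)
    {φ : β → ℝ≥0∞} (hφ : AEMeasurable φ ν) :
    ∫⁻ x, (∫⁻ y, ENNReal.ofReal (κ x y) * φ y ∂ν) ^ 2 ∂μ ≤ ∫⁻ y, φ y ^ 2 ∂ν :=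
  (lintegral_mono fun x => h.lintegral_mul_sq_le hφ x).trans
    (h.lintegral_lintegral_mul_le (hφ.pow_const 2))

theorem enorm_smul_eq (h : IsSubstochastic μ ν κ) (x : α) (y : β) (q : E) :
    ‖κ x y • q‖ₑ = ENNReal.ofReal (κ x y) * ‖q‖ₑ := by
  rw [enorm_smul, Real.enorm_of_nonneg (h.nonneg x y)]

theorem ae_integrable_smul [SFinite μ] [SFinite ν] (h : IsSubstochastic μ ν κ) {q : β → E}
    (hq : MemLp q 2 ν) : ∀ᵐ x ∂μ, Integrable (fun y => κ x y • q y) ν := by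
  have hm : AEMeasurable (fun x => (∫⁻ y, ENNReal.ofReal (κ x y) * ‖q y‖ₑ ∂ν) ^ 2) μ :=
    (AEMeasurable.lintegral_prod_right'
      (h.measurable.ennreal_ofReal.aemeasurable.mul hq.1.enorm.comp_snd)).pow_const 2
  filter_upwards [ae_lt_top' hm ((h.lintegral_sq_lintegral_mul_le hq.1.enorm).trans_lt
    (lintegral_sq_enorm_lt_top hq)).ne] with x hx
  refine ⟨(h.measurable_row x).aestronglyMeasurable.smul hq.1, ?_⟩
  rw [hasFiniteIntegral_iff_enorm]
  simpa only [h.enorm_smul_eq, ENNReal.pow_lt_top_iff, OfNat.ofNat_ne_zero, or_false] using hx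

theorem eLpNorm_integral_le [SFinite μ] [SFinite ν] (h : IsSubstochastic μ ν κ) {q : β → E}
    (hq : AEStronglyMeasurable q ν) :
    eLpNorm (fun x => ∫ y, κ x y • q y ∂ν) 2 μ ≤ eLpNorm q 2 ν := by
  rw [eLpNorm_eq_lintegral_rpow_enorm_toReal two_ne_zero ENNReal.ofNat_ne_top,
    eLpNorm_eq_lintegral_rpow_enorm_toReal two_ne_zero ENNReal.ofNat_ne_top]
  refine ENNReal.rpow_le_rpow ?_ (by positivity)
  simp only [ENNReal.toReal_ofNat, ENNReal.rpow_ofNat]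
  refine (lintegral_mono fun x => ?_).trans (h.lintegral_sq_lintegral_mul_le hq.enorm)
  gcongr
  exact (enorm_integral_le_lintegral_enorm _).trans_eq
    (lintegral_congr fun y => h.enorm_smul_eq x y (q y))

theorem memLp_integral [SFinite μ] [SFinite ν] (h : IsSubstochastic μ ν κ) {q : β → E}
    (hq : MemLp q 2 ν) : MemLp (fun x => ∫ y, κ x y • q y ∂ν) 2 μ :=
  ⟨AEStronglyMeasurable.integral_prod_right' (f := fun z : α × β => κ z.1 z.2 • q z.2)
    (h.measurable.aestronglyMeasurable.smul hq.1.comp_snd),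
    (h.eLpNorm_integral_le hq.1).trans_lt hq.2⟩

/-- The contraction `q ↦ ∫ κ(·, y) q(y) dy` of `L²` with kernel `κ`. -/
def op [SFinite μ] [SFinite ν] (h : IsSubstochastic μ ν κ) : Lp 𝕜 2 ν →L[𝕜] Lp 𝕜 2 μ :=
  LinearMap.mkContinuous
    { toFun := fun q => (h.memLp_integral (Lp.memLp q)).toLp _
      map_add' := fun q q' => by
        rw [← MemLp.toLp_add, MemLp.toLp_eq_toLp_iff]
        filter_upwards [h.ae_integrable_smul (Lp.memLp q),
          h.ae_integrable_smul (Lp.memLp q')] with x hx hx'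
        rw [Pi.add_apply, ← integral_add hx hx']
        refine integral_congr_ae ?_
        filter_upwards [Lp.coeFn_add q q'] with y hy
        rw [hy, Pi.add_apply, smul_add]
      map_smul' := fun c q => by
        rw [RingHom.id_apply, ← MemLp.toLp_const_smul, MemLp.toLp_eq_toLp_iff]
        refine Eventually.of_forall fun x => ?_
        rw [Pi.smul_apply, ← integral_smul]
        refine integral_congr_ae ?_
        filter_upwards [Lp.coeFn_smul c q] with y hy
        rw [hy, Pi.smul_apply, smul_comm] }
    1 fun q => by
      rw [one_mul, Lp.norm_def]
      refine ENNReal.toReal_mono (Lp.eLpNorm_ne_top q) ?_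
      exact (eLpNorm_congr_ae (h.memLp_integral (Lp.memLp q)).coeFn_toLp).trans_le
        (h.eLpNorm_integral_le (Lp.memLp q).1)

theorem coeFn_op [SFinite μ] [SFinite ν] (h : IsSubstochastic μ ν κ) (q : Lp 𝕜 2 ν) :
    h.op q =ᵐ[μ] fun x => ∫ y, κ x y • q y ∂ν :=
  (h.memLp_integral (Lp.memLp q)).coeFn_toLp

theorem integrable_prod [SFinite μ] [SFinite ν] (h : IsSubstochastic μ ν κ) {p : α → 𝕜} {q : β → 𝕜}
    (hp : MemLp p 2 μ) (hq : MemLp q 2 ν) :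
    Integrable (fun z : α × β => κ z.1 z.2 • (q z.2 * p z.1)) (μ.prod ν) := by
  have hm : AEMeasurable (fun z : α × β => ENNReal.ofReal (κ z.1 z.2)) (μ.prod ν) :=
    h.measurable.ennreal_ofReal.aemeasurable
  have hmq := hm.mul (hq.1.comp_snd.enorm.pow_const 2)
  have hq_lt : ∫⁻ z, ENNReal.ofReal (κ z.1 z.2) * ‖q z.2‖ₑ ^ 2 ∂(μ.prod ν) < ∞ :=
    (lintegral_prod _ hmq).trans_lt ((h.lintegral_lintegral_mul_le
      (hq.1.enorm.pow_const 2)).trans_lt (lintegral_sq_enorm_lt_top hq))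
  have hp_lt : ∫⁻ z, ENNReal.ofReal (κ z.1 z.2) * ‖p z.1‖ₑ ^ 2 ∂(μ.prod ν) < ∞ :=
    (lintegral_prod_symm _ (hm.mul (hp.1.comp_fst.enorm.pow_const 2))).trans_lt
      ((h.swap.lintegral_lintegral_mul_le (hp.1.enorm.pow_const 2)).trans_lt
        (lintegral_sq_enorm_lt_top hp))
  refine ⟨h.measurable.aestronglyMeasurable.smul (hq.1.comp_snd.mul hp.1.comp_fst), ?_⟩
  rw [hasFiniteIntegral_iff_enorm]
  refine (lintegral_mono fun z => ?_).trans_lt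
    ((lintegral_add_left' hmq _).trans_lt (ENNReal.add_lt_top.2 ⟨hq_lt, hp_lt⟩))
  simp only [Pi.mul_apply, h.enorm_smul_eq, enorm_mul, ← mul_add]
  gcongr
  rcases le_total ‖q z.2‖ₑ ‖p z.1‖ₑ with hle | hle
  · exact (by rw [sq]; gcongr : _ ≤ ‖p z.1‖ₑ ^ 2).trans le_add_self
  · exact (by rw [sq]; gcongr : _ ≤ ‖q z.2‖ₑ ^ 2).trans le_self_add

theorem inner_op_left [SFinite μ] [SFinite ν] (h : IsSubstochastic μ ν κ) (q : Lp 𝕜 2 ν)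
    (p : Lp 𝕜 2 μ) : ⟪h.op q, p⟫_𝕜 = ⟪q, h.swap.op p⟫_𝕜 := by
  have hq : MemLp (fun y => (starRingEnd 𝕜) (q y)) 2 ν := (Lp.memLp q).star
  have hleft : ⟪h.op q, p⟫_𝕜 = ∫ x, ∫ y, κ x y • ((starRingEnd 𝕜) (q y) * p x) ∂ν ∂μ := by
    rw [L2.inner_def]
    refine integral_congr_ae ?_
    filter_upwards [h.coeFn_op q] with x hx
    simp only [hx, RCLike.inner_apply', ← integral_conj, RCLike.conj_smul, ← integral_mul_const,
      smul_mul_assoc]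
  have hright : ⟪q, h.swap.op p⟫_𝕜 = ∫ y, ∫ x, κ x y • ((starRingEnd 𝕜) (q y) * p x) ∂μ ∂ν := by
    rw [L2.inner_def]
    refine integral_congr_ae ?_
    filter_upwards [h.swap.coeFn_op p] with y hy
    simp only [hy, RCLike.inner_apply', ← integral_const_mul, mul_smul_comm]
  rw [hleft, hright]
  exact integral_integral_swap (h.integrable_prod (Lp.memLp p) hq)

end IsSubstochastic

/-! ### Calculus of locally absolutely continuous functions -/

theorem absolutelyContinuousOnInterval_of_dist_le {X Y : Type*} [PseudoMetricSpace X]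
    [PseudoMetricSpace Y] {f : ℝ → X} {g : ℝ → Y} {x y : ℝ}
    (hg : AbsolutelyContinuousOnInterval g x y)
    (h : ∀ s ∈ uIcc x y, ∀ t ∈ uIcc x y, dist (f s) (f t) ≤ dist (g s) (g t)) :
    AbsolutelyContinuousOnInterval f x y := by
  refine squeeze_zero' (Eventually.of_forall fun _ => Finset.sum_nonneg fun _ _ => dist_nonneg)
    ?_ hg
  filter_upwards [mem_inf_of_right (mem_principal_self _)] with E hE
  exact Finset.sum_le_sum fun i hi => h _ (hE.1 i hi).1 _ (hE.1 i hi).2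

theorem absolutelyContinuousOnInterval_of_sub_eq_integral {E : Type*} [NormedAddCommGroup E]
    [NormedSpace ℝ E] {F G : ℝ → E} {x y : ℝ} (hG : IntervalIntegrable G volume x y)
    (h : ∀ s ∈ uIcc x y, ∀ t ∈ uIcc x y, F t - F s = ∫ u in s..t, G u) :
    AbsolutelyContinuousOnInterval F x y := by
  refine absolutelyContinuousOnInterval_of_dist_le
    (hG.norm.absolutelyContinuousOnInterval_intervalIntegral left_mem_uIcc) fun s hs t ht => ?_
  have hx : ∀ z ∈ uIcc x y, IntervalIntegrable (fun u => ‖G u‖) volume x z := fun z hz =>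
    hG.norm.mono_set (uIcc_subset_uIcc_left hz)
  rw [dist_eq_norm, Real.dist_eq, intervalIntegral.integral_interval_sub_left (hx s hs) (hx t ht),
    h t ht s hs]
  exact intervalIntegral.norm_integral_le_abs_integral_norm

theorem sub_eq_integral_of_ae_hasDerivAt {E : Type*} [NormedAddCommGroup E] [NormedSpace ℝ E]
    [CompleteSpace E] {F G : ℝ → E} {x y : ℝ} (hF : AbsolutelyContinuousOnInterval F x y)
    (hG : IntervalIntegrable G volume x y) (h : ∀ᵐ z, z ∈ uIcc x y → HasDerivAt F (G z) z) :
    F y - F x = ∫ t in x..y, G t := by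
  have hprim : AbsolutelyContinuousOnInterval (fun z => ∫ t in x..z, G t) x y := by
    refine absolutelyContinuousOnInterval_of_sub_eq_integral hG fun s hs t ht => ?_
    exact intervalIntegral.integral_interval_sub_left (hG.mono_set (uIcc_subset_uIcc_left ht))
      (hG.mono_set (uIcc_subset_uIcc_left hs))
  obtain ⟨C, hC⟩ := (hF.sub hprim).const_of_ae_hasDerivAt_zero (by
    filter_upwards [h, hG.ae_hasDerivAt_integral] with z hz hz' hzI
    simpa using (hz hzI).sub (hz' hzI x left_mem_uIcc))
  have hx := hC x left_mem_uIcc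
  have hy := hC y right_mem_uIcc
  simp only [Pi.sub_apply, intervalIntegral.integral_same, sub_zero] at hx hy
  rw [hx, ← hy, sub_sub_cancel]

namespace HasACDerivOn

variable {F G F' G' : ℝ → ℂ} {I J : Set ℝ}

theorem mono (h : HasACDerivOn F G I) (hJ : J ⊆ I) : HasACDerivOn F G J :=
  fun x hx y hy => h x (hJ hx) y (hJ hy)

theorem congr [OrdConnected I] (h : HasACDerivOn F G I) (hF : ∀ z ∈ I, F' z = F z)
    (hG : G' =ᵐ[volume.restrict I] G) : HasACDerivOn F' G' I := by
  intro x hx y hy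
  obtain ⟨hint, hsub⟩ := h x hx y hy
  have hG' : G =ᵐ[volume.restrict (uIoc x y)] G' := ae_restrict_of_ae_restrict_of_subset
    (uIoc_subset_uIcc.trans (OrdConnected.uIcc_subset ‹_› hx hy)) hG.symm
  refine ⟨hint.congr_ae hG', ?_⟩
  rw [hF x hx, hF y hy, hsub]
  exact intervalIntegral.integral_congr_ae_restrict hG'

theorem of_hasDerivAt [OrdConnected I] (h : ∀ z ∈ I, HasDerivAt F (G z) z)
    (hG : ContinuousOn G I) : HasACDerivOn F G I := by
  intro x hx y hy
  have hsub : uIcc x y ⊆ I := OrdConnected.uIcc_subset ‹_› hx hy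
  have hint : IntervalIntegrable G volume x y := (hG.mono hsub).intervalIntegrable
  exact ⟨hint,
    (intervalIntegral.integral_eq_sub_of_hasDerivAt (fun z hz => h z (hsub hz)) hint).symm⟩

theorem of_intervalIntegrable (hG : ∀ x ∈ I, ∀ y ∈ I, IntervalIntegrable G volume x y) {c : ℝ}
    (hc : c ∈ I) : HasACDerivOn (fun z => ∫ t in c..z, G t) G I := fun x hx y hy =>
  ⟨hG x hx y hy, intervalIntegral.integral_interval_sub_left (hG c hc y hy) (hG c hc x hx)⟩

theorem absolutelyContinuousOnInterval [OrdConnected I] (h : HasACDerivOn F G I) {x y : ℝ}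
    (hx : x ∈ I) (hy : y ∈ I) : AbsolutelyContinuousOnInterval F x y := by
  have hsub : uIcc x y ⊆ I := OrdConnected.uIcc_subset ‹_› hx hy
  exact absolutelyContinuousOnInterval_of_sub_eq_integral (h x hx y hy).1 fun s hs t ht =>
    (h s (hsub hs) t (hsub ht)).2

theorem continuousOn (hI : IsOpen I) [OrdConnected I] (h : HasACDerivOn F G I) :
    ContinuousOn F I := by
  intro x hx
  obtain ⟨ε, hε, hball⟩ := Metric.isOpen_iff.1 hI x hx
  rw [Real.ball_eq_Ioo] at hball
  have hcont := (h.absolutelyContinuousOnInterval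
    (hball ⟨by linarith, by linarith⟩ : x - ε / 2 ∈ I)
    (hball ⟨by linarith, by linarith⟩ : x + ε / 2 ∈ I)).continuousOn
  rw [uIcc_of_le (by linarith)] at hcont
  exact (hcont.continuousAt (Icc_mem_nhds (by linarith) (by linarith))).continuousWithinAt

theorem eventuallyEq_integral (hI : IsOpen I) (h : HasACDerivOn F G I) {x z : ℝ} (hx : x ∈ I)
    (hz : z ∈ I) : F =ᶠ[𝓝 z] fun y => F x + ∫ t in x..y, G t := by
  filter_upwards [hI.mem_nhds hz] with y hy
  rw [← (h x hx y hy).2, add_sub_cancel]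

theorem hasDerivAt (hI : IsOpen I) (h : HasACDerivOn F G I) (hG : ContinuousOn G I)
    {x : ℝ} (hx : x ∈ I) : HasDerivAt F (G x) x :=
  ((intervalIntegral.integral_hasDerivAt_right (h x hx x hx).1
    (hG.stronglyMeasurableAtFilter hI x hx) (hG.continuousAt (hI.mem_nhds hx))).const_add
      (F x)).congr_of_eventuallyEq (h.eventuallyEq_integral hI hx hx)

theorem ae_hasDerivAt (hI : IsOpen I) [OrdConnected I] (h : HasACDerivOn F G I) {x y : ℝ}
    (hx : x ∈ I) (hy : y ∈ I) : ∀ᵐ z, z ∈ uIcc x y → HasDerivAt F (G z) z := by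
  filter_upwards [(h x hx y hy).1.ae_hasDerivAt_integral] with z hz hzI
  exact ((hz hzI x left_mem_uIcc).const_add (F x)).congr_of_eventuallyEq
    (h.eventuallyEq_integral hI hx (OrdConnected.uIcc_subset ‹_› hx hy hzI))

theorem mul (hI : IsOpen I) [OrdConnected I] (h : HasACDerivOn F G I)
    (h' : HasACDerivOn F' G' I) :
    HasACDerivOn (fun z => F z * F' z) (fun z => G z * F' z + F z * G' z) I := by
  intro x hx y hy
  have hF := h.absolutelyContinuousOnInterval hx hy
  have hF' := h'.absolutelyContinuousOnInterval hx hy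
  have hint : IntervalIntegrable (fun z => G z * F' z + F z * G' z) volume x y :=
    ((h x hx y hy).1.mul_continuousOn hF'.continuousOn).add
      ((h' x hx y hy).1.continuousOn_mul hF.continuousOn)
  refine ⟨hint, sub_eq_integral_of_ae_hasDerivAt (hF.fun_smul hF') hint ?_⟩
  filter_upwards [h.ae_hasDerivAt hI hx hy, h'.ae_hasDerivAt hI hx hy] with z hz hz' hzI
  exact (hz hzI).mul (hz' hzI)

theorem ofReal_mul (hI : IsOpen I) [OrdConnected I] {E E' : ℝ → ℝ} (h : HasACDerivOn F G I)
    (hE : ∀ z ∈ I, HasDerivAt E (E' z) z) (hE' : ContinuousOn E' I) :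
    HasACDerivOn (fun z => (E z : ℂ) * F z) (fun z => (E' z : ℂ) * F z + (E z : ℂ) * G z) I :=
  mul hI (of_hasDerivAt (fun z hz => (hE z hz).ofReal_comp)
    (Complex.continuous_ofReal.comp_continuousOn hE')) h

theorem eq_of_continuousWithinAt (h : HasACDerivOn F 0 I) {s : ℝ} (hs : s ∈ closure I)
    (hc : ContinuousWithinAt F I s) {x : ℝ} (hx : x ∈ I) : F x = F s := by
  have := mem_closure_iff_nhdsWithin_neBot.1 hs
  refine tendsto_nhds_unique (tendsto_const_nhds.congr' ?_) hc
  filter_upwards [self_mem_nhdsWithin] with z hz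
  simpa [sub_eq_zero, eq_comm] using (h x hx z hz).2

theorem of_Iio_of_Ioo {s e : ℝ} (hs : s < e) (hl : HasACDerivOn F G (Iio s))
    (hr : HasACDerivOn F G (Ioo s e)) (hc : ContinuousAt F s)
    (hG : ∀ x ∈ Iio e, ∀ y ∈ Iio e, IntervalIntegrable G volume x y) :
    HasACDerivOn F G (Iio e) := by
  have hprim := of_intervalIntegrable hG hs
  set K := F + (-1 : ℂ) • fun z => ∫ t in s..z, G t with hK
  have hKc : ContinuousAt K s :=
    hc.add (((hprim.continuousOn isOpen_Iio).continuousAt (Iio_mem_nhds hs)).const_smul (-1 : ℂ))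
  have hG0 : G + (-1 : ℂ) • G = 0 := by rw [neg_one_smul, add_neg_cancel]
  have hconst : ∀ x ∈ Iio e, K x = K s := by
    intro x hx
    rcases lt_trichotomy x s with h | rfl | h
    · exact eq_of_continuousWithinAt (hG0 ▸ hl.add ((hprim.mono (Iio_subset_Iio hs.le)).smul _))
        (by simp) hKc.continuousWithinAt h
    · rfl
    · exact eq_of_continuousWithinAt (hG0 ▸ hr.add ((hprim.mono Ioo_subset_Iio_self).smul _))
        (by simp [closure_Ioo hs.ne, hs.le]) hKc.continuousWithinAt (mem_Ioo.2 ⟨h, hx⟩)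
  intro x hx y hy
  refine ⟨hG x hx y hy, ?_⟩
  rw [← (hprim x hx y hy).2]
  have hxy : K y = K x := (hconst y hy).trans (hconst x hx).symm
  simp only [hK, Pi.add_apply, Pi.smul_apply, smul_eq_mul] at hxy
  linear_combination hxy

theorem eq_exp (hI : IsOpen I) [OrdConnected I] {α : ℂ}
    (h : HasACDerivOn F (fun z => α * F z) I) :
    ∃ C : ℂ, ∀ z ∈ I, F z = C * Complex.exp (α * z) := by
  rcases I.eq_empty_or_nonempty with rfl | ⟨x, hx⟩
  · exact ⟨0, by simp⟩
  have hexp : ∀ z ∈ I, HasDerivAt (fun z : ℝ => Complex.exp (-α * z))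
      (-α * Complex.exp (-α * z)) z := fun z _ => by
    simpa [mul_comm] using ((hasDerivAt_id (z : ℂ)).const_mul (-α)).cexp.comp_ofReal
  have hconst := mul hI h (of_hasDerivAt hexp (by fun_prop))
  refine ⟨F x * Complex.exp (-α * x), fun z hz => ?_⟩
  have hxz : F z * _ - F x * _ = _ := (hconst x hx z hz).2
  rw [intervalIntegral.integral_congr (g := fun _ => 0) (fun t _ => by ring),
    intervalIntegral.integral_zero, sub_eq_zero] at hxz
  rw [← hxz, mul_assoc, ← Complex.exp_add]
  simp

end HasACDerivOn

local notation "vol₋" => (Measure.restrict (volume : Measure ℝ) (Iio (0 : ℝ)))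

/-! ### The first-order operators on the half line -/

theorem intervalIntegrable_of_memLp {E : Type*} [NormedAddCommGroup E] {q : ℝ → E} {p : ℝ≥0∞}
    (hp : 1 ≤ p) {e : ℝ} (hq : MemLp q p (volume.restrict (Iio e))) {x y : ℝ} (hx : x ≤ e)
    (hy : y ≤ e) : IntervalIntegrable q volume x y := by
  rw [intervalIntegrable_iff]
  rw [restrict_Iio_eq_restrict_Iic] at hq
  have hsub : uIoc x y ⊆ Iic e := fun z hz => hz.2.trans (max_le hx hy)
  have : IsFiniteMeasure (volume.restrict (uIoc x y)) := ⟨by simp [uIoc]⟩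
  exact (hq.mono_measure (Measure.restrict_mono_set _ hsub)).integrable hp

theorem integrable_inner_of_memLp {α E 𝕜 : Type*} [MeasurableSpace α] {μ : Measure α} [RCLike 𝕜]
    [NormedAddCommGroup E] [InnerProductSpace 𝕜 E] {p q : α → E} (hp : MemLp p 2 μ)
    (hq : MemLp q 2 μ) : Integrable (fun x => ⟪p x, q x⟫_𝕜) μ := by
  refine (L2.integrable_inner (𝕜 := 𝕜) (hp.toLp p) (hq.toLp q)).congr ?_
  filter_upwards [hp.coeFn_toLp, hq.coeFn_toLp] with x hpx hqx
  rw [hpx, hqx]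

theorem tendsto_atBot_zero_of_memLp {E : Type*} [NormedAddCommGroup E] [InnerProductSpace ℝ E]
    {P P₁ : ℝ → E} {e : ℝ} (h : ∀ z < e, HasDerivAt P (P₁ z) z)
    (hP : MemLp P 2 (volume.restrict (Iio e))) (hP₁ : MemLp P₁ 2 (volume.restrict (Iio e))) :
    Tendsto P atBot (𝓝 0) := by
  have hsub : Iic (e - 1) ⊆ Iio e := Iic_subset_Iio.2 (by linarith)
  have hsq : Tendsto (fun z => ‖P z‖ ^ 2) atBot (𝓝 0) :=
    tendsto_zero_of_hasDerivAt_of_integrableOn_Iic (a := e - 1)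
      (f' := fun z => 2 * ⟪P z, P₁ z⟫_ℝ) (fun z hz => (h z (hsub hz)).norm_sq)
      (IntegrableOn.mono_set ((integrable_inner_of_memLp hP hP₁).const_mul 2) hsub)
      (IntegrableOn.mono_set ((memLp_two_iff_integrable_sq_norm hP.1).1 hP) hsub)
  rw [tendsto_zero_iff_norm_tendsto_zero]
  simpa using hsq.sqrt

theorem HasACDerivOn.eqOn_zero_of_tendsto {F : ℝ → ℂ} {e : ℝ} (h : HasACDerivOn F F (Iio e))
    (he : Tendsto F (𝓝[<] e) (𝓝 0)) : EqOn F 0 (Iio e) := by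
  obtain ⟨C, hC⟩ := HasACDerivOn.eq_exp (α := 1) isOpen_Iio (by simpa only [one_mul] using h)
  have hlim : Tendsto (fun z : ℝ => C * Complex.exp (1 * z)) (𝓝[<] e)
      (𝓝 (C * Complex.exp (1 * e))) :=
    (Continuous.tendsto (by fun_prop) e).mono_left nhdsWithin_le_nhds
  have hC0 : C = 0 := by
    simpa using tendsto_nhds_unique (hlim.congr' (eventually_nhdsWithin_of_forall
      fun z hz => (hC z hz).symm)) he
  intro z hz
  simp [hC z hz, hC0]

theorem HasACDerivOn.eqOn_zero_of_memLp {F : ℝ → ℂ} {e : ℝ} (h : HasACDerivOn F (-F) (Iio e))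
    (hF : MemLp F 2 (volume.restrict (Iio e))) : EqOn F 0 (Iio e) := by
  obtain ⟨C, hC⟩ := HasACDerivOn.eq_exp (α := -1) isOpen_Iio
    (by simp only [neg_one_mul]; exact h)
  have hconst : MemLp (fun _ : ℝ => C * Complex.exp (-1 * e)) 2 (volume.restrict (Iio e)) := by
    refine hF.mono aestronglyMeasurable_const ?_
    filter_upwards [ae_restrict_mem measurableSet_Iio] with z hz
    rw [hC z hz, norm_mul, norm_mul, Complex.norm_exp, Complex.norm_exp]
    refine mul_le_mul_of_nonneg_left (Real.exp_le_exp.2 ?_) (norm_nonneg C)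
    simpa using le_of_lt hz
  have hC0 : C = 0 := by
    rw [memLp_const_iff two_ne_zero ENNReal.ofNat_ne_top] at hconst
    simpa using hconst
  intro z hz
  simp [hC z hz, hC0]

/-- The Green kernel of `p' - p = -q`, `p(0) = 0`, on the half line. -/
def expKernel (z t : ℝ) : ℝ := if z < t then Real.exp (z - t) else 0

theorem lintegral_expKernel_right (z : ℝ) : ∫⁻ t, ENNReal.ofReal (expKernel z t) = 1 := by
  calc ∫⁻ t, ENNReal.ofReal (expKernel z t)
      = ∫⁻ t in Ioi z, ENNReal.ofReal (Real.exp z * Real.exp (-t)) := by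
        rw [← lintegral_indicator measurableSet_Ioi]
        refine lintegral_congr fun t => ?_
        by_cases h : z < t <;> simp [expKernel, h, sub_eq_add_neg, Real.exp_add]
    _ = ENNReal.ofReal (∫ t in Ioi z, Real.exp z * Real.exp (-t)) :=
        (ofReal_integral_eq_lintegral_ofReal ((integrableOn_exp_neg_Ioi z).const_mul _)
          (Eventually.of_forall fun t => by positivity)).symm
    _ = 1 := by
        rw [integral_const_mul, integral_exp_neg_Ioi, ← Real.exp_add]
        simp

theorem lintegral_expKernel_left (t : ℝ) : ∫⁻ z, ENNReal.ofReal (expKernel z t) = 1 := by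
  calc ∫⁻ z, ENNReal.ofReal (expKernel z t)
      = ∫⁻ z in Iic t, ENNReal.ofReal (Real.exp (-t) * Real.exp z) := by
        rw [← restrict_Iio_eq_restrict_Iic, ← lintegral_indicator measurableSet_Iio]
        refine lintegral_congr fun z => ?_
        by_cases h : z < t <;> simp [expKernel, h, sub_eq_add_neg, Real.exp_add, mul_comm]
    _ = ENNReal.ofReal (∫ z in Iic t, Real.exp (-t) * Real.exp z) :=
        (ofReal_integral_eq_lintegral_ofReal ((integrableOn_exp_Iic t).const_mul _)
          (Eventually.of_forall fun z => by positivity)).symm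
    _ = 1 := by
        rw [integral_const_mul, integral_exp_Iic, ← Real.exp_add]
        simp

theorem isSubstochastic_expKernel {S T : Set ℝ} :
    IsSubstochastic (volume.restrict S) (volume.restrict T) expKernel where
  measurable := Measurable.ite (measurableSet_lt measurable_fst measurable_snd) (by fun_prop)
    measurable_const
  nonneg z t := by unfold expKernel; split_ifs <;> positivity
  row z := (setLIntegral_le_lintegral _ _).trans_eq (lintegral_expKernel_right z)
  col t := (setLIntegral_le_lintegral _ _).trans_eq (lintegral_expKernel_left t)

/-- The solution `p` of `p' - p = q`, `p(0) = 0`. -/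
def backward (q : ℝ → ℂ) (z : ℝ) : ℂ := -∫ t, expKernel z t • q t ∂vol₋

/-- The decaying solution `w` of `w' = -w - h`. -/
def forward (h : ℝ → ℂ) (t : ℝ) : ℂ := -∫ z, expKernel z t • h z ∂vol₋

section

variable {q h : ℝ → ℂ}

theorem backward_congr {q' : ℝ → ℂ} (hqq' : q =ᵐ[vol₋] q') : backward q = backward q' := by
  funext z
  refine congrArg Neg.neg (integral_congr_ae ?_)
  filter_upwards [hqq'] with t ht
  rw [ht]

theorem memLp_backward (hq : MemLp q 2 vol₋) : MemLp (backward q) 2 vol₋ :=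
  (isSubstochastic_expKernel.memLp_integral hq).neg

theorem memLp_forward (hh : MemLp h 2 vol₋) : MemLp (forward h) 2 vol₋ :=
  (isSubstochastic_expKernel.swap.memLp_integral hh).neg

theorem backward_eq_exp_mul {z : ℝ} (hz : z < 0) :
    backward q z = (Real.exp z : ℂ) * ∫ t in 0..z, (Real.exp (-t) : ℂ) * q t := by
  rw [backward, intervalIntegral.integral_of_ge hz.le, ← restrict_Ioo_eq_restrict_Ioc, mul_neg,
    ← integral_const_mul, ← integral_indicator measurableSet_Iio,
    ← integral_indicator measurableSet_Ioo]
  congr 2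
  funext t
  by_cases h0 : t < 0 <;> by_cases h : z < t <;>
    simp [h0, h, expKernel, indicator, sub_eq_add_neg, Real.exp_add, mul_assoc]

theorem forward_eq_exp_mul {t : ℝ} (ht : t < 0) :
    forward h t = (Real.exp (-t) : ℂ) * -∫ z in Iic t, (Real.exp z : ℂ) * h z := by
  rw [forward, ← restrict_Iio_eq_restrict_Iic, mul_neg, ← integral_const_mul,
    ← integral_indicator measurableSet_Iio, ← integral_indicator measurableSet_Iio]
  congr 2
  funext z
  by_cases h0 : z < t
  · simp [h0, h0.trans ht, expKernel, indicator, sub_eq_add_neg, Real.exp_add, ← mul_assoc,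
      mul_comm]
  · simp [h0, expKernel, indicator]

theorem intervalIntegrable_exp_neg_mul (hq : MemLp q 2 vol₋) {x y : ℝ} (hx : x ≤ 0) (hy : y ≤ 0) :
    IntervalIntegrable (fun t => (Real.exp (-t) : ℂ) * q t) volume x y :=
  (intervalIntegrable_of_memLp one_le_two hq hx hy).continuousOn_mul (by fun_prop)

theorem integrableOn_exp_mul (hh : MemLp h 2 vol₋) :
    IntegrableOn (fun z => (Real.exp z : ℂ) * h z) (Iio 0) := by
  have hexp : MemLp Real.exp 2 vol₋ := by
    rw [memLp_two_iff_integrable_sq (by fun_prop), restrict_Iio_eq_restrict_Iic]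
    simp only [← Real.exp_nat_mul, Nat.cast_ofNat]
    exact integrableOn_exp_mul_Iic two_pos 0
  exact hexp.ofReal.integrable_mul hh

theorem hasACDerivOn_backward (hq : MemLp q 2 vol₋) :
    HasACDerivOn (backward q) (backward q + q) (Iio 0) := by
  have hprim : HasACDerivOn (fun z => ∫ t in 0..z, (Real.exp (-t) : ℂ) * q t)
      (fun t => (Real.exp (-t) : ℂ) * q t) (Iio 0) :=
    (HasACDerivOn.of_intervalIntegrable
      (fun x hx y hy => intervalIntegrable_exp_neg_mul hq hx hy) self_mem_Iic).mono
      Iio_subset_Iic_self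
  refine (HasACDerivOn.ofReal_mul isOpen_Iio hprim (fun z _ => Real.hasDerivAt_exp z)
    Real.continuous_exp.continuousOn).congr (fun z hz => backward_eq_exp_mul hz) ?_
  filter_upwards [ae_restrict_mem measurableSet_Iio] with z hz
  rw [Pi.add_apply, backward_eq_exp_mul hz, ← mul_assoc, ← Complex.ofReal_mul, ← Real.exp_add]
  simp

theorem hasACDerivOn_forward (hh : MemLp h 2 vol₋) :
    HasACDerivOn (forward h) (-forward h - h) (Iio 0) := by
  have hint := integrableOn_exp_mul hh
  have hprim : HasACDerivOn (fun t => -∫ z in Iic t, (Real.exp z : ℂ) * h z)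
      (fun z => -((Real.exp z : ℂ) * h z)) (Iio 0) := fun x hx y hy => by
    have hloc := intervalIntegrable_of_memLp one_le_two hh (le_of_lt hx) (le_of_lt hy)
    refine ⟨(hloc.continuousOn_mul (by fun_prop)).neg, ?_⟩
    rw [intervalIntegral.integral_neg, ← intervalIntegral.integral_Iic_sub_Iic
      (hint.mono_set (Iic_subset_Iio.2 hx)) (hint.mono_set (Iic_subset_Iio.2 hy))]
    ring
  have hexp : ∀ z ∈ Iio (0 : ℝ), HasDerivAt (fun z => Real.exp (-z)) (-Real.exp (-z)) z :=
    fun z _ => by simpa using (hasDerivAt_id z).neg.exp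
  refine (HasACDerivOn.ofReal_mul isOpen_Iio hprim hexp (by fun_prop)).congr
    (fun z hz => forward_eq_exp_mul hz) ?_
  filter_upwards [ae_restrict_mem measurableSet_Iio] with z hz
  rw [Pi.sub_apply, Pi.neg_apply, forward_eq_exp_mul hz, mul_neg, mul_neg, mul_neg, ← mul_assoc,
    ← Complex.ofReal_mul, ← Real.exp_add]
  simp [sub_eq_add_neg]

theorem tendsto_backward_zero (hq : MemLp q 2 vol₋) : Tendsto (backward q) (𝓝[<] 0) (𝓝 0) := by
  have hint := intervalIntegrable_exp_neg_mul hq le_rfl (by norm_num : (-1 : ℝ) ≤ 0)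
  have hprim : Tendsto (fun z => ∫ t in 0..z, (Real.exp (-t) : ℂ) * q t) (𝓝[<] 0) (𝓝 0) := by
    have hcont := intervalIntegral.continuousOn_primitive_interval' hint left_mem_uIcc
      0 left_mem_uIcc
    have hle : 𝓝[<] (0 : ℝ) ≤ 𝓝[uIcc 0 (-1)] 0 := by
      rw [uIcc_of_ge (by norm_num)]
      exact nhdsWithin_le_iff.2 (mem_of_superset (Ioo_mem_nhdsLT (by norm_num : (-1 : ℝ) < 0))
        Ioo_subset_Icc_self)
    simpa using hcont.tendsto.mono_left hle
  have hexp : Tendsto (fun z : ℝ => (Real.exp z : ℂ)) (𝓝[<] 0) (𝓝 (Real.exp 0 : ℂ)) :=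
    (Continuous.tendsto (by fun_prop) 0).mono_left nhdsWithin_le_nhds
  have hlim := hexp.mul hprim
  rw [mul_zero] at hlim
  exact hlim.congr' (eventually_nhdsWithin_of_forall fun z hz => (backward_eq_exp_mul hz).symm)

theorem eqOn_backward {P P₁ : ℝ → ℂ} (hP : HasACDerivOn P P₁ (Iio 0))
    (h0 : Tendsto P (𝓝[<] 0) (𝓝 0)) (hq : MemLp (P₁ - P) 2 vol₋) :
    EqOn P (backward (P₁ - P)) (Iio 0) := by
  have hdiff : HasACDerivOn (P + (-1 : ℂ) • backward (P₁ - P))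
      (P + (-1 : ℂ) • backward (P₁ - P)) (Iio 0) :=
    (hP.add ((hasACDerivOn_backward hq).smul (-1))).congr (fun _ _ => rfl)
      (Eventually.of_forall fun z => by simp; ring)
  have hlim := h0.add ((tendsto_backward_zero hq).const_smul (-1 : ℂ))
  rw [smul_zero, add_zero] at hlim
  intro z hz
  simpa [← sub_eq_add_neg, sub_eq_zero] using hdiff.eqOn_zero_of_tendsto hlim hz

theorem eqOn_forward {w : ℝ → ℂ} (hw : HasACDerivOn w (-w - h) (Iio 0)) (hw2 : MemLp w 2 vol₋)
    (hh : MemLp h 2 vol₋) : EqOn w (forward h) (Iio 0) := by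
  have hdiff : HasACDerivOn (w + (-1 : ℂ) • forward h) (-(w + (-1 : ℂ) • forward h)) (Iio 0) :=
    (hw.add ((hasACDerivOn_forward hh).smul (-1))).congr (fun _ _ => rfl)
      (Eventually.of_forall fun z => by simp; ring)
  intro z hz
  simpa [← sub_eq_add_neg, sub_eq_zero] using
    hdiff.eqOn_zero_of_memLp (hw2.add ((memLp_forward hh).const_smul (-1 : ℂ))) hz

end

/-- `backward` as an operator. -/
def backwardOp : L2Neg →L[ℂ] L2Neg := -isSubstochastic_expKernel.op

/-- `forward` as an operator. -/
def forwardOp : L2Neg →L[ℂ] L2Neg := -isSubstochastic_expKernel.swap.op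

theorem coeFn_backwardOp (q : L2Neg) : backwardOp q =ᵐ[vol₋] backward q := by
  filter_upwards [Lp.coeFn_neg (isSubstochastic_expKernel.op q),
    isSubstochastic_expKernel.coeFn_op q] with z hneg hop
  rw [backwardOp, neg_apply, hneg, Pi.neg_apply, hop, backward]

theorem coeFn_forwardOp (h : L2Neg) : forwardOp h =ᵐ[vol₋] forward h := by
  filter_upwards [Lp.coeFn_neg (isSubstochastic_expKernel.swap.op h),
    isSubstochastic_expKernel.swap.coeFn_op h] with z hneg hop
  rw [forwardOp, neg_apply, hneg, Pi.neg_apply, hop, forward]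

theorem inner_forwardOp_left (h q : L2Neg) : ⟪forwardOp h, q⟫_ℂ = ⟪h, backwardOp q⟫_ℂ := by
  rw [forwardOp, backwardOp, neg_apply, neg_apply,
    inner_neg_left, inner_neg_right, isSubstochastic_expKernel.swap.inner_op_left]

/-! ### Multiplication operators -/

section

variable {α : Type*} [MeasurableSpace α] {μ : Measure α} {m : α → ℝ}

theorem re_inner_eq_integral (p f : Lp ℂ 2 μ) : (⟪p, f⟫_ℂ).re = ∫ x, ⟪p x, f x⟫_ℝ ∂μ := by
  rw [L2.inner_def]
  exact (integral_re (𝕜 := ℂ) (L2.integrable_inner (𝕜 := ℂ) p f)).symm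

theorem norm_sq_eq_integral (p : Lp ℂ 2 μ) : ‖p‖ ^ 2 = ∫ x, ‖p x‖ ^ 2 ∂μ := by
  simp only [← real_inner_self_eq_norm_sq, ← re_inner_eq_integral]
  rw [real_inner_self_eq_norm_sq]
  exact (inner_self_eq_norm_sq (𝕜 := ℂ) p).symm

theorem real_inner_ofReal_mul (x y : ℂ) (c : ℝ) : ⟪x, (c : ℂ) * y⟫_ℝ = c * ⟪x, y⟫_ℝ := by
  rw [← Complex.real_smul, real_inner_smul_right]

theorem memLp_ofReal_mul {p : ℝ≥0∞} (hm : MemLp m ∞ μ) {f : α → ℂ} (hf : MemLp f p μ) :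
    MemLp (fun x => (m x : ℂ) * f x) p μ :=
  hf.mul hm.ofReal

/-- Multiplication by a bounded real function. -/
def mulOp (hm : MemLp m ∞ μ) : Lp ℂ 2 μ →L[ℂ] Lp ℂ 2 μ :=
  (ContinuousLinearMap.mul ℂ ℂ).holderL μ ∞ 2 2 (hm.ofReal.toLp _)

theorem coeFn_mulOp (hm : MemLp m ∞ μ) (f : Lp ℂ 2 μ) :
    mulOp hm f =ᵐ[μ] fun x => (m x : ℂ) * f x := by
  have hm' : MemLp (fun x => (m x : ℂ)) ∞ μ := hm.ofReal
  filter_upwards [(ContinuousLinearMap.mul ℂ ℂ).coeFn_holder (r := 2) (hm'.toLp _) f,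
    hm'.coeFn_toLp] with x hprod hcoeff
  exact hprod.trans (by rw [hcoeff]; rfl)

theorem mul_norm_sq_le_re_inner_mulOp (hm : MemLp m ∞ μ) {c : ℝ} (hc : ∀ᵐ x ∂μ, c ≤ m x)
    (f : Lp ℂ 2 μ) : c * ‖f‖ ^ 2 ≤ (⟪f, mulOp hm f⟫_ℂ).re := by
  rw [re_inner_eq_integral, norm_sq_eq_integral, ← integral_const_mul]
  refine integral_mono_ae (((memLp_two_iff_integrable_sq_norm (Lp.memLp f).1).1
    (Lp.memLp f)).const_mul c) (integrable_inner_of_memLp (Lp.memLp _) (Lp.memLp _)) ?_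
  filter_upwards [coeFn_mulOp hm f, hc] with x hprod hx
  rw [hprod, real_inner_ofReal_mul, real_inner_self_eq_norm_sq]
  exact mul_le_mul_of_nonneg_right hx (sq_nonneg _)

end

/-! ### Second-order operators whose leading coefficient has a kink -/

/-- The coefficients of an elliptic operator `p ↦ (d p)'' + c p' + r p` on `(-∞, 0)`: bounded
functions `d` and `r`, where `d` is bounded below by a positive constant and has bounded
derivatives `d₁`, `d₂`, except that it may have a kink at `s`. -/
structure IsKinked (s : ℝ) (d d₁ d₂ r : ℝ → ℝ) : Prop where
  neg : s < 0
  hasDerivAt : ∀ z < 0, z ≠ s → HasDerivAt d (d₁ z) z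
  hasDerivAt_one : ∀ z < 0, z ≠ s → HasDerivAt d₁ (d₂ z) z
  continuousAt : ContinuousAt d s
  continuousOn_two : ContinuousOn d₂ (Iio 0 \ {s})
  continuousOn_pot : ContinuousOn r (Iio 0 \ {s})
  bounded : ∃ M, ∀ z < 0, z ≠ s → |d z| ≤ M ∧ |d₁ z| ≤ M ∧ |d₂ z| ≤ M ∧ |r z| ≤ M
  pos : ∃ m > 0, ∀ z < 0, m ≤ d z

theorem memLp_top_of_continuousOn_diff {μ : Measure ℝ} [NullSingletonClass μ] {S : Set ℝ}
    (hS : MeasurableSet S) {s M : ℝ} {m : ℝ → ℝ} (hm : ContinuousOn m (S \ {s}))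
    (hM : ∀ z ∈ S, z ≠ s → |m z| ≤ M) : MemLp m ∞ (μ.restrict S) := by
  have hr : μ.restrict S = μ.restrict (S \ {s}) :=
    Measure.restrict_congr_set (sdiff_null_ae_eq_self (measure_singleton s)).symm
  have hS' : MeasurableSet (S \ {s}) := hS.diff (measurableSet_singleton s)
  rw [hr]
  refine memLp_top_of_bound (C := M) (hm.aestronglyMeasurable hS') ?_
  filter_upwards [ae_restrict_mem hS'] with z hz
  exact hM z hz.1 hz.2

namespace IsKinked

variable {s : ℝ} {d d₁ d₂ r : ℝ → ℝ}

theorem coeff_pos (h : IsKinked s d d₁ d₂ r) {z : ℝ} (hz : z < 0) : 0 < d z := by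
  obtain ⟨m, hm, hmd⟩ := h.pos
  exact hm.trans_le (hmd z hz)

theorem continuousOn (h : IsKinked s d d₁ d₂ r) : ContinuousOn d (Iio 0) := by
  intro z hz
  rcases eq_or_ne z s with rfl | hs
  · exact h.continuousAt.continuousWithinAt
  · exact (h.hasDerivAt z hz hs).continuousAt.continuousWithinAt

theorem continuousOn_one (h : IsKinked s d d₁ d₂ r) : ContinuousOn d₁ (Iio 0 \ {s}) :=
  fun z hz => (h.hasDerivAt_one z hz.1 hz.2).continuousAt.continuousWithinAt

theorem continuousOn_inv (h : IsKinked s d d₁ d₂ r) : ContinuousOn (fun z => (d z)⁻¹) (Iio 0) :=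
  h.continuousOn.inv₀ fun _ hz => (h.coeff_pos hz).ne'

theorem hasDerivAt_inv (h : IsKinked s d d₁ d₂ r) {z : ℝ} (hz : z < 0) (hs : z ≠ s) :
    HasDerivAt (fun y => (d y)⁻¹) (-d₁ z / d z ^ 2) z :=
  (h.hasDerivAt z hz hs).inv (h.coeff_pos hz).ne'

theorem continuousOn_deriv_inv (h : IsKinked s d d₁ d₂ r) :
    ContinuousOn (fun z => -d₁ z / d z ^ 2) (Iio 0 \ {s}) :=
  h.continuousOn_one.neg.div ((h.continuousOn.mono sdiff_subset).pow 2) fun _ hz =>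
    (pow_pos (h.coeff_pos hz.1) 2).ne'

theorem memLp_coeff (h : IsKinked s d d₁ d₂ r) : MemLp d ∞ vol₋ := by
  obtain ⟨M, hM⟩ := h.bounded
  exact memLp_top_of_continuousOn_diff measurableSet_Iio (h.continuousOn.mono sdiff_subset)
    fun z hz hs => (hM z hz hs).1

theorem memLp_one (h : IsKinked s d d₁ d₂ r) : MemLp d₁ ∞ vol₋ := by
  obtain ⟨M, hM⟩ := h.bounded
  exact memLp_top_of_continuousOn_diff measurableSet_Iio h.continuousOn_one
    fun z hz hs => (hM z hz hs).2.1

theorem memLp_two (h : IsKinked s d d₁ d₂ r) : MemLp d₂ ∞ vol₋ := by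
  obtain ⟨M, hM⟩ := h.bounded
  exact memLp_top_of_continuousOn_diff measurableSet_Iio h.continuousOn_two
    fun z hz hs => (hM z hz hs).2.2.1

theorem memLp_drift (h : IsKinked s d d₁ d₂ r) (c : ℝ) : MemLp (fun z => d₁ z + c) ∞ vol₋ :=
  h.memLp_one.add (memLp_top_const c)

theorem memLp_pot (h : IsKinked s d d₁ d₂ r) : MemLp (fun z => d₂ z + r z) ∞ vol₋ := by
  obtain ⟨M, hM⟩ := h.bounded
  exact h.memLp_two.add (memLp_top_of_continuousOn_diff measurableSet_Iio h.continuousOn_pot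
    fun z hz hs => (hM z hz hs).2.2.2)

theorem memLp_inv (h : IsKinked s d d₁ d₂ r) : MemLp (fun z => (d z)⁻¹) ∞ vol₋ := by
  obtain ⟨m, hm, hmd⟩ := h.pos
  refine memLp_top_of_continuousOn_diff (s := s) (M := m⁻¹) measurableSet_Iio
    (h.continuousOn_inv.mono sdiff_subset) fun z hz _ => ?_
  rw [abs_of_pos (inv_pos.2 (h.coeff_pos hz))]
  exact inv_anti₀ hm (hmd z hz)

theorem tendsto_drift_mul {E : Type*} [NormedAddCommGroup E] {P : ℝ → E}
    (h : IsKinked s d d₁ d₂ r) (c : ℝ) {l : Filter ℝ} (hl : ∀ᶠ z in l, z < 0 ∧ z ≠ s)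
    (hP : Tendsto P l (𝓝 0)) :
    Tendsto (fun z => (d₁ z + c) * ‖P z‖ ^ 2) l (𝓝 0) := by
  obtain ⟨M, hM⟩ := h.bounded
  have hsq : Tendsto (fun z => ‖P z‖ ^ 2) l (𝓝 0) := by simpa using hP.norm.pow 2
  refine isBoundedUnder_le_mul_tendsto_zero ⟨M + |c|, eventually_map.2 ?_⟩ hsq
  filter_upwards [hl] with z hz
  exact (norm_add_le _ _).trans (add_le_add_left (hM z hz.1 hz.2).2.1 _)

end IsKinked

/-! ### Dissipativity -/

theorem integral_Iio_of_hasDerivAt_of_tendsto {E : Type*} [NormedAddCommGroup E]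
    [NormedSpace ℝ E] [CompleteSpace E] {A A' : ℝ → E} {s e : ℝ} {m l u n : E} (hs : s < e)
    (hA : ∀ z < e, z ≠ s → HasDerivAt A (A' z) z) (hint : IntegrableOn A' (Iio e))
    (hm : Tendsto A atBot (𝓝 m)) (hl : Tendsto A (𝓝[<] s) (𝓝 l))
    (hu : Tendsto A (𝓝[>] s) (𝓝 u)) (hn : Tendsto A (𝓝[<] e) (𝓝 n)) :
    ∫ z in Iio e, A' z = (l - m) + (n - u) := by
  rw [IntegrableOn, restrict_Iio_eq_restrict_Iic] at hint
  have hintl : IntegrableOn A' (Iic s) := IntegrableOn.mono_set hint (Iic_subset_Iic.2 hs.le)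
  have hintr : IntegrableOn A' (Ioc s e) := IntegrableOn.mono_set hint fun z hz => hz.2
  have hleft : ∫ z in Iic s, A' z = l - m := by
    have hupdate : ∀ z < s, Function.update A s l =ᶠ[𝓝 z] A := fun z hz => by
      filter_upwards [Iio_mem_nhds hz] with y hy using Function.update_of_ne (ne_of_lt hy) _ _
    have hftc := integral_Iic_of_hasDerivAt_of_tendsto (f := Function.update A s l) (f' := A')
      (by rwa [continuousWithinAt_update_same, Iic_sdiff_right])
      (fun z hz => (hA z (lt_trans hz hs) (ne_of_lt hz)).congr_of_eventuallyEq (hupdate z hz))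
      hintl (hm.congr' (mem_of_superset (Iio_mem_atBot s)
        fun z hz => (hupdate z hz).self_of_nhds.symm))
    rwa [Function.update_self] at hftc
  have hright : ∫ z in s..e, A' z = n - u :=
    intervalIntegral.integral_eq_sub_of_hasDerivAt_of_tendsto hs
      (fun z hz => hA z hz.2 (ne_of_gt hz.1))
      ((intervalIntegrable_iff_integrableOn_Ioc_of_le hs.le).2 hintr) hu hn
  rw [restrict_Iio_eq_restrict_Iic, ← Iic_union_Ioc_eq_Iic hs.le,
    setIntegral_union (Iic_disjoint_Ioc le_rfl) measurableSet_Ioc hintl hintr,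
    ← intervalIntegral.integral_of_le hs.le, hleft, hright]

/-- Coefficients for which `p ↦ (d p)'' + c p' + r p` is dissipative, whatever the speed `c`: the
potential `d₂ / 2 + r` left by integrating by parts is negative, and the kink of `d` is convex. -/
structure IsDissipative (s : ℝ) (d d₁ d₂ r : ℝ → ℝ) : Prop extends IsKinked s d d₁ d₂ r where
  stable : ∃ δ > 0, ∀ z < 0, z ≠ s → 1 / 2 * d₂ z + r z ≤ -δ
  kink : ∃ jl jr, Tendsto d₁ (𝓝[<] s) (𝓝 jl) ∧ Tendsto d₁ (𝓝[>] s) (𝓝 jr) ∧ jl ≤ jr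

section Energy

variable {E : Type*} [NormedAddCommGroup E] [InnerProductSpace ℝ E] {s : ℝ} {d d₁ d₂ r : ℝ → ℝ}
  {P P₁ : ℝ → E}

theorem IsKinked.integrable_deriv_drift_mul (h : IsKinked s d d₁ d₂ r) (c : ℝ)
    (hP : MemLp P 2 vol₋) (hP₁ : MemLp P₁ 2 vol₋) :
    Integrable (fun z => d₂ z * ‖P z‖ ^ 2 + (d₁ z + c) * (2 * ⟪P z, P₁ z⟫_ℝ)) vol₋ :=
  (((memLp_two_iff_integrable_sq_norm hP.1).1 hP).mul_of_top_right h.memLp_two).add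
    (((integrable_inner_of_memLp hP hP₁).const_mul 2).mul_of_top_right (h.memLp_drift c))

theorem IsDissipative.integral_deriv_drift_mul_nonpos (h : IsDissipative s d d₁ d₂ r) (c : ℝ)
    (hP : ∀ z < 0, HasDerivAt P (P₁ z) z) (hP2 : MemLp P 2 vol₋) (hP12 : MemLp P₁ 2 vol₋)
    (h0 : Tendsto P (𝓝[<] 0) (𝓝 0)) :
    ∫ z, (d₂ z * ‖P z‖ ^ 2 + (d₁ z + c) * (2 * ⟪P z, P₁ z⟫_ℝ)) ∂vol₋ ≤ 0 := by
  obtain ⟨jl, jr, hjl, hjr, hj⟩ := h.kink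
  have hbot : ∀ᶠ z in atBot, z < 0 ∧ z ≠ s :=
    mem_of_superset (Iio_mem_atBot s) fun z hz => ⟨lt_trans hz h.neg, ne_of_lt hz⟩
  have hfront : ∀ᶠ z in 𝓝[<] (0 : ℝ), z < 0 ∧ z ≠ s :=
    mem_of_superset (Ioo_mem_nhdsLT h.neg) fun z hz => ⟨hz.2, ne_of_gt hz.1⟩
  have hPs : Tendsto (fun z => ‖P z‖ ^ 2) (𝓝 s) (𝓝 (‖P s‖ ^ 2)) :=
    (hP s h.neg).continuousAt.norm.pow 2
  rw [integral_Iio_of_hasDerivAt_of_tendsto h.neg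
    (fun z hz hzs => ((h.hasDerivAt_one z hz hzs).add_const c).mul (hP z hz).norm_sq)
    (h.integrable_deriv_drift_mul c hP2 hP12)
    (h.tendsto_drift_mul c hbot (tendsto_atBot_zero_of_memLp hP hP2 hP12))
    ((hjl.add_const c).mul (hPs.mono_left nhdsWithin_le_nhds))
    ((hjr.add_const c).mul (hPs.mono_left nhdsWithin_le_nhds)) (h.tendsto_drift_mul c hfront h0)]
  linarith [mul_le_mul_of_nonneg_right (add_le_add_left hj c) (sq_nonneg ‖P s‖)]

theorem IsDissipative.integral_inner_le (h : IsDissipative s d d₁ d₂ r) (c : ℝ) {δ : ℝ}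
    (hδ : ∀ z < 0, z ≠ s → 1 / 2 * d₂ z + r z ≤ -δ)
    (hP : ∀ z < 0, HasDerivAt P (P₁ z) z) (hP2 : MemLp P 2 vol₋) (hP12 : MemLp P₁ 2 vol₋)
    (h0 : Tendsto P (𝓝[<] 0) (𝓝 0)) :
    ∫ z, ((d₁ z + c) * ⟪P z, P₁ z⟫_ℝ + (d₂ z + r z) * ‖P z‖ ^ 2) ∂vol₋ ≤
      -δ * ∫ z, ‖P z‖ ^ 2 ∂vol₋ := by
  have hnorm : Integrable (fun z => ‖P z‖ ^ 2) vol₋ :=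
    (memLp_two_iff_integrable_sq_norm hP2.1).1 hP2
  have htotal := h.integrable_deriv_drift_mul c hP2 hP12
  calc ∫ z, ((d₁ z + c) * ⟪P z, P₁ z⟫_ℝ + (d₂ z + r z) * ‖P z‖ ^ 2) ∂vol₋
      ≤ ∫ z, (1 / 2 * (d₂ z * ‖P z‖ ^ 2 + (d₁ z + c) * (2 * ⟪P z, P₁ z⟫_ℝ)) +
          -δ * ‖P z‖ ^ 2) ∂vol₋ := by
        refine integral_mono_ae (((integrable_inner_of_memLp hP2 hP12).mul_of_top_right
          (h.memLp_drift c)).add (hnorm.mul_of_top_right h.memLp_pot))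
          ((htotal.const_mul _).add (hnorm.const_mul _)) ?_
        filter_upwards [ae_restrict_mem measurableSet_Iio,
          ae_restrict_of_ae (Measure.ae_ne volume s)] with z hz hzs
        linarith [mul_le_mul_of_nonneg_right (hδ z hz hzs) (sq_nonneg ‖P z‖)]
    _ = 1 / 2 * ∫ z, (d₂ z * ‖P z‖ ^ 2 + (d₁ z + c) * (2 * ⟪P z, P₁ z⟫_ℝ)) ∂vol₋ +
          -δ * ∫ z, ‖P z‖ ^ 2 ∂vol₋ := by
        rw [integral_add (htotal.const_mul _) (hnorm.const_mul _), integral_const_mul,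
          integral_const_mul]
    _ ≤ -δ * ∫ z, ‖P z‖ ^ 2 ∂vol₋ := by
        linarith [h.integral_deriv_drift_mul_nonpos c hP hP2 hP12 h0]

end Energy

/-! ### The variational formulation -/

theorem inner_forwardOp_right (q h : L2Neg) : ⟪q, forwardOp h⟫_ℂ = ⟪backwardOp q, h⟫_ℂ := by
  rw [← inner_conj_symm, inner_forwardOp_left, inner_conj_symm]

/-- `p'` as a function of `q = p' - p`. -/
def derivOp : L2Neg →L[ℂ] L2Neg := backwardOp + 1

theorem derivOp_apply (q : L2Neg) : derivOp q = backwardOp q + q := rfl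

theorem coeFn_derivOp (q : L2Neg) : derivOp q =ᵐ[vol₋] backward q + q := by
  filter_upwards [Lp.coeFn_add (backwardOp q) q, coeFn_backwardOp q] with z hadd hback
  rw [derivOp_apply, hadd, Pi.add_apply, hback, Pi.add_apply]

theorem norm_sq_le_derivOp (q : L2Neg) :
    ‖q‖ ^ 2 ≤ 2 * (‖derivOp q‖ ^ 2 + ‖backwardOp q‖ ^ 2) := by
  have hq : ‖q‖ ≤ ‖derivOp q‖ + ‖backwardOp q‖ := by
    simpa [derivOp_apply] using norm_sub_le (derivOp q) (backwardOp q)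
  exact (pow_le_pow_left₀ (norm_nonneg q) hq 2).trans (add_sq_le ..)

namespace IsKinked

variable {s : ℝ} {d d₁ d₂ r : ℝ → ℝ}

/-- The flux `d p'` as a function of `q = p' - p`. -/
def flux (h : IsKinked s d d₁ d₂ r) : L2Neg →L[ℂ] L2Neg :=
  mulOp h.memLp_coeff ∘L derivOp

/-- The remainder `(d' + c) p' + (d'' + r) p` of `(d p)'' + c p' + r p` after its leading term
`d p''`, as a function of `q = p' - p`. -/
def lowerOrder (h : IsKinked s d d₁ d₂ r) (c : ℝ) : L2Neg →L[ℂ] L2Neg :=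
  mulOp (h.memLp_drift c) ∘L derivOp + mulOp h.memLp_pot ∘L backwardOp

theorem coeFn_flux (h : IsKinked s d d₁ d₂ r) (q : L2Neg) :
    h.flux q =ᵐ[vol₋] fun z => (d z : ℂ) * (backward q z + q z) := by
  filter_upwards [coeFn_mulOp h.memLp_coeff (derivOp q), coeFn_derivOp q] with z hmul hderiv
  rw [flux, ContinuousLinearMap.comp_apply, hmul, hderiv, Pi.add_apply]

theorem coeFn_lowerOrder (h : IsKinked s d d₁ d₂ r) (c : ℝ) (q : L2Neg) :
    h.lowerOrder c q =ᵐ[vol₋] fun z => ((d₁ z + c : ℝ) : ℂ) * (backward q z + q z) +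
      ((d₂ z + r z : ℝ) : ℂ) * backward q z := by
  filter_upwards [coeFn_mulOp (h.memLp_drift c) (derivOp q), coeFn_derivOp q,
    coeFn_mulOp h.memLp_pot (backwardOp q), coeFn_backwardOp q,
    Lp.coeFn_add (mulOp (h.memLp_drift c) (derivOp q)) (mulOp h.memLp_pot (backwardOp q))]
    with z hdrift hderiv hpot hback hadd
  rw [lowerOrder, add_apply, ContinuousLinearMap.comp_apply, ContinuousLinearMap.comp_apply, hadd,
    Pi.add_apply, hdrift, hderiv, hpot, hback, Pi.add_apply]

/-- The operator on `L²` representing the sesquilinear form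
`⟪p, (d' + c) v' + (d'' + r - μ) v⟫ - ⟪p', d v'⟫` in the variables `p' - p` and `v' - v`. -/
def formOp (h : IsKinked s d d₁ d₂ r) (c : ℝ) (μ : ℂ) : L2Neg →L[ℂ] L2Neg :=
  forwardOp ∘L (h.lowerOrder c - μ • backwardOp) - (forwardOp + 1) ∘L h.flux

theorem formOp_apply (h : IsKinked s d d₁ d₂ r) (c : ℝ) (μ : ℂ) (q : L2Neg) :
    h.formOp c μ q = forwardOp (h.lowerOrder c q - μ • backwardOp q) -
      (forwardOp (h.flux q) + h.flux q) := rfl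

theorem formOp_eq_iff (h : IsKinked s d d₁ d₂ r) (c : ℝ) (μ : ℂ) (q f : L2Neg) :
    h.formOp c μ q = forwardOp f ↔
      h.flux q = forwardOp (h.lowerOrder c q - h.flux q - (f + μ • backwardOp q)) := by
  simp only [formOp_apply, map_sub, map_add]
  grind

theorem inner_formOp (h : IsKinked s d d₁ d₂ r) (c : ℝ) (μ : ℂ) (p q : L2Neg) :
    ⟪p, h.formOp c μ q⟫_ℂ = ⟪backwardOp p, h.lowerOrder c q⟫_ℂ -
      μ * ⟪backwardOp p, backwardOp q⟫_ℂ - ⟪derivOp p, h.flux q⟫_ℂ := by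
  rw [formOp_apply, inner_sub_right, inner_add_right, inner_forwardOp_right,
    inner_forwardOp_right, inner_sub_right, inner_smul_right, derivOp_apply, inner_add_left]

end IsKinked

namespace IsDissipative

variable {s : ℝ} {d d₁ d₂ r : ℝ → ℝ}

theorem re_inner_lowerOrder_le (h : IsDissipative s d d₁ d₂ r) (c : ℝ) {δ : ℝ}
    (hδ : ∀ z < 0, z ≠ s → 1 / 2 * d₂ z + r z ≤ -δ) (q : L2Neg) :
    (⟪backwardOp q, h.lowerOrder c q⟫_ℂ).re ≤ -δ * ‖backwardOp q‖ ^ 2 := by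
  refine (Lp.boundedContinuousFunction_dense ℂ vol₋ (p := 2) ENNReal.ofNat_ne_top).induction ?_
    (isClosed_le (by fun_prop) (by fun_prop)) q
  intro q hq
  obtain ⟨g, hg⟩ := Lp.mem_boundedContinuousFunction_iff.1 hq
  have hqg : q =ᵐ[vol₋] g := hg ▸ g.toContinuousMap.coeFn_toAEEqFun vol₋
  have hgm : MemLp g 2 vol₋ := (memLp_congr_ae hqg).1 (Lp.memLp q)
  have hback : backwardOp q =ᵐ[vol₋] backward g := by
    rw [← backward_congr hqg]
    exact coeFn_backwardOp q
  have hac := hasACDerivOn_backward hgm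
  have hcont : ContinuousOn (backward g + ⇑g) (Iio 0) :=
    (hac.continuousOn isOpen_Iio).add g.continuous.continuousOn
  have henergy := h.integral_inner_le c hδ (fun z hz => hac.hasDerivAt isOpen_Iio hcont hz)
    (memLp_backward hgm) ((memLp_backward hgm).add hgm) (tendsto_backward_zero hgm)
  rw [re_inner_eq_integral, norm_sq_eq_integral]
  convert henergy using 1
  · refine integral_congr_ae ?_
    filter_upwards [h.coeFn_lowerOrder c q, hback, hqg] with z hlow hb hz
    rw [hlow, hb, hz, backward_congr hqg, inner_add_right, real_inner_ofReal_mul,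
      real_inner_ofReal_mul, real_inner_self_eq_norm_sq, Pi.add_apply]
  · congr 1
    refine integral_congr_ae ?_
    filter_upwards [hback] with z hb
    rw [hb]

theorem re_inner_formOp_le (h : IsDissipative s d d₁ d₂ r) (c : ℝ) {δ m : ℝ} {μ : ℂ}
    (hδ : ∀ z < 0, z ≠ s → 1 / 2 * d₂ z + r z ≤ -δ) (hm : ∀ z < 0, m ≤ d z) (hμ : 0 ≤ μ.re)
    (q : L2Neg) :
    (⟪q, h.formOp c μ q⟫_ℂ).re ≤ -(m * ‖derivOp q‖ ^ 2 + δ * ‖backwardOp q‖ ^ 2) := by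
  have hshift : (μ * ⟪backwardOp q, backwardOp q⟫_ℂ).re = μ.re * ‖backwardOp q‖ ^ 2 := by
    rw [inner_self_eq_norm_sq_to_K, RCLike.ofReal_eq_complex_ofReal, ← Complex.ofReal_pow,
      Complex.re_mul_ofReal]
  have hflux := mul_norm_sq_le_re_inner_mulOp h.memLp_coeff
    ((ae_restrict_mem measurableSet_Iio).mono hm) (derivOp q)
  rw [h.inner_formOp, Complex.sub_re, Complex.sub_re, hshift, IsKinked.flux,
    ContinuousLinearMap.comp_apply]
  linarith [h.re_inner_lowerOrder_le c hδ q, mul_nonneg hμ (sq_nonneg ‖backwardOp q‖)]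

theorem isUnit_formOp (h : IsDissipative s d d₁ d₂ r) (c : ℝ) {μ : ℂ} (hμ : 0 ≤ μ.re) :
    IsUnit (h.formOp c μ) := by
  obtain ⟨m, hm, hmd⟩ := h.pos
  obtain ⟨δ, hδ, hst⟩ := h.stable
  have hκ : 0 < min m δ / 2 := half_pos (lt_min hm hδ)
  refine ContinuousLinearMap.isUnit_of_forall_le_norm_inner_map _ (c := ⟨min m δ / 2, hκ.le⟩) hκ
    fun q => ?_
  calc ‖q‖ ^ 2 * (min m δ / 2)
      ≤ min m δ * ‖derivOp q‖ ^ 2 + min m δ * ‖backwardOp q‖ ^ 2 := by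
        linarith [mul_le_mul_of_nonneg_left (norm_sq_le_derivOp q) hκ.le]
    _ ≤ m * ‖derivOp q‖ ^ 2 + δ * ‖backwardOp q‖ ^ 2 := by
        gcongr
        exacts [min_le_left m δ, min_le_right m δ]
    _ ≤ -(⟪q, h.formOp c μ q⟫_ℂ).re := by linarith [h.re_inner_formOp_le c hst hmd hμ q]
    _ ≤ ‖⟪h.formOp c μ q, q⟫_ℂ‖ := by
        rw [norm_inner_symm]
        exact (neg_le_abs _).trans (Complex.abs_re_le_norm _)

end IsDissipative

/-! ### The resolvent -/

/-- `g = (d p)'' + c p' + r p` for an admissible `p`, with a shock at `s`: the relation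
`IsLinearisation` for general coefficients. -/
def IsImage (s c : ℝ) (d r : ℝ → ℝ) (p g : L2Neg) : Prop :=
  ∃ P P₁ P₂ Q Q₁ : ℝ → ℂ,
    IsAdmissible s P P₁ P₂ ∧
    p =ᵐ[vol₋] P ∧
    (∀ z < 0, z ≠ s → HasDerivAt (fun y => (d y : ℂ) * P y) (Q z) z) ∧
    HasACDerivOn Q Q₁ (Iio s) ∧
    HasACDerivOn Q Q₁ (Ioo s 0) ∧
    g =ᵐ[vol₋] fun z => Q₁ z + (c : ℂ) * P₁ z + (r z : ℂ) * P z

/-- The equation `(d P)'' + c P' + r P = g` with `P(0) = 0` as a first-order system for `P` and the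
flux `d P₁`, where `P₁ = P'`. As `P₁` is continuous, the kink of `d` is not seen by the flux. -/
structure IsFluxSolution (c : ℝ) (d d₁ d₂ r : ℝ → ℝ) (P P₁ g : ℝ → ℂ) : Prop where
  hasACDerivOn : HasACDerivOn P P₁ (Iio 0)
  hasACDerivOn_flux : HasACDerivOn (fun z => (d z : ℂ) * P₁ z)
    (fun z => g z - ((d₁ z + c : ℝ) : ℂ) * P₁ z - ((d₂ z + r z : ℝ) : ℂ) * P z) (Iio 0)
  memLp : MemLp P 2 vol₋
  memLp_one : MemLp P₁ 2 vol₋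
  front : Tendsto P (𝓝[<] 0) (𝓝 0)

theorem Iio_subset_Iio_diff {α : Type*} [Preorder α] {s e : α} (hs : s < e) :
    Iio s ⊆ Iio e \ {s} :=
  fun _ hz => ⟨lt_trans hz hs, ne_of_lt hz⟩

theorem Ioo_subset_Iio_diff {α : Type*} [Preorder α] {s e : α} : Ioo s e ⊆ Iio e \ {s} :=
  fun _ hz => ⟨hz.2, ne_of_gt hz.1⟩

namespace IsKinked

variable {s : ℝ} {d d₁ d₂ r : ℝ → ℝ}

theorem ofReal_coeff_ne_zero (h : IsKinked s d d₁ d₂ r) {z : ℝ} (hz : z < 0) : (d z : ℂ) ≠ 0 :=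
  Complex.ofReal_ne_zero.2 (h.coeff_pos hz).ne'

theorem inv_mul_coeff_mul (h : IsKinked s d d₁ d₂ r) {z : ℝ} (hz : z < 0) (w : ℂ) :
    (((d z)⁻¹ : ℝ) : ℂ) * ((d z : ℂ) * w) = w := by
  rw [Complex.ofReal_inv, inv_mul_cancel_left₀ (h.ofReal_coeff_ne_zero hz)]

theorem coeff_mul_inv_mul (h : IsKinked s d d₁ d₂ r) {z : ℝ} (hz : z < 0) (w : ℂ) :
    (d z : ℂ) * ((((d z)⁻¹ : ℝ) : ℂ) * w) = w := by
  rw [Complex.ofReal_inv, mul_inv_cancel_left₀ (h.ofReal_coeff_ne_zero hz)]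

end IsKinked

namespace IsFluxSolution

variable {s c : ℝ} {d d₁ d₂ r : ℝ → ℝ} {P P₁ g : ℝ → ℂ} {J : Set ℝ}

theorem continuousOn (hP : IsFluxSolution c d d₁ d₂ r P P₁ g) (h : IsKinked s d d₁ d₂ r) :
    ContinuousOn P₁ (Iio 0) :=
  ((Complex.continuous_ofReal.comp_continuousOn h.continuousOn_inv).mul
    (hP.hasACDerivOn_flux.continuousOn isOpen_Iio)).congr
      fun _ hz => (h.inv_mul_coeff_mul hz _).symm

theorem hasACDerivOn_one (hP : IsFluxSolution c d d₁ d₂ r P P₁ g) (h : IsKinked s d d₁ d₂ r)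
    (hJo : IsOpen J) [OrdConnected J] (hJ : J ⊆ Iio 0 \ {s}) :
    HasACDerivOn P₁ (fun z => (((d z)⁻¹ : ℝ) : ℂ) *
      (g z - ((2 * d₁ z + c : ℝ) : ℂ) * P₁ z - ((d₂ z + r z : ℝ) : ℂ) * P z)) J := by
  refine (HasACDerivOn.ofReal_mul hJo (hP.hasACDerivOn_flux.mono (hJ.trans sdiff_subset))
    (fun z hz => h.hasDerivAt_inv (hJ hz).1 (hJ hz).2) (h.continuousOn_deriv_inv.mono hJ)).congr
    (fun z hz => (h.inv_mul_coeff_mul (hJ hz).1 _).symm) ?_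
  filter_upwards [ae_restrict_mem hJo.measurableSet] with z hz
  have hd : (d z : ℂ) ≠ 0 := h.ofReal_coeff_ne_zero (hJ hz).1
  push_cast
  field_simp
  ring

theorem hasACDerivOn_deriv_mul (hP : IsFluxSolution c d d₁ d₂ r P P₁ g)
    (h : IsKinked s d d₁ d₂ r) (hJo : IsOpen J) [OrdConnected J] (hJ : J ⊆ Iio 0 \ {s}) :
    HasACDerivOn (fun z => (d₁ z : ℂ) * P z + (d z : ℂ) * P₁ z)
      (fun z => g z - (c : ℂ) * P₁ z - (r z : ℂ) * P z) J := by
  refine ((HasACDerivOn.ofReal_mul hJo (hP.hasACDerivOn.mono (hJ.trans sdiff_subset))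
    (fun z hz => h.hasDerivAt_one z (hJ hz).1 (hJ hz).2) (h.continuousOn_two.mono hJ)).add
    (hP.hasACDerivOn_flux.mono (hJ.trans sdiff_subset))).congr (fun _ _ => rfl)
    (Eventually.of_forall fun z => ?_)
  simp only [Pi.add_apply]
  push_cast
  ring

end IsFluxSolution

namespace IsKinked

variable {s c : ℝ} {d d₁ d₂ r : ℝ → ℝ}

theorem isImage_of_isFluxSolution (h : IsKinked s d d₁ d₂ r) {p g : L2Neg} {P P₁ : ℝ → ℂ}
    (hp : p =ᵐ[vol₋] P) (hP : IsFluxSolution c d d₁ d₂ r P P₁ g) : IsImage s c d r p g := by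
  have hderiv : ∀ z < 0, HasDerivAt P (P₁ z) z := fun z hz =>
    hP.hasACDerivOn.hasDerivAt isOpen_Iio (hP.continuousOn h) hz
  have hdrift : MemLp (fun z => 2 * d₁ z + c) ∞ vol₋ :=
    (h.memLp_one.const_mul 2).add (memLp_top_const c)
  refine ⟨P, P₁, _, _, _, ⟨hderiv, hP.continuousOn h,
    hP.hasACDerivOn_one h isOpen_Iio (Iio_subset_Iio_diff h.neg),
    hP.hasACDerivOn_one h isOpen_Ioo Ioo_subset_Iio_diff, hP.memLp, hP.memLp_one, ?_, hP.front,
    tendsto_atBot_zero_of_memLp hderiv hP.memLp hP.memLp_one⟩, hp, fun z hz hzs =>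
    (h.hasDerivAt z hz hzs).ofReal_comp.mul (hderiv z hz),
    hP.hasACDerivOn_deriv_mul h isOpen_Iio (Iio_subset_Iio_diff h.neg),
    hP.hasACDerivOn_deriv_mul h isOpen_Ioo Ioo_subset_Iio_diff,
    Eventually.of_forall fun z => by ring⟩
  exact memLp_ofReal_mul h.memLp_inv (((Lp.memLp g).sub (memLp_ofReal_mul hdrift hP.memLp_one)).sub
    (memLp_ofReal_mul h.memLp_pot hP.memLp))

theorem hasACDerivOn_flux_of_hasDerivAt (h : IsKinked s d d₁ d₂ r) {P P₁ Q Q₁ g : ℝ → ℂ}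
    {J : Set ℝ} (hJo : IsOpen J) [OrdConnected J] (hJ : J ⊆ Iio 0 \ {s})
    (hP : HasACDerivOn P P₁ J) (hP₁ : ∀ z ∈ J, HasDerivAt P (P₁ z) z)
    (hQ : ∀ z ∈ J, HasDerivAt (fun y => (d y : ℂ) * P y) (Q z) z) (hQ₁ : HasACDerivOn Q Q₁ J)
    (hg : g =ᵐ[volume.restrict J] fun z => Q₁ z + (c : ℂ) * P₁ z + (r z : ℂ) * P z) :
    HasACDerivOn (fun z => (d z : ℂ) * P₁ z)
      (fun z => g z - ((d₁ z + c : ℝ) : ℂ) * P₁ z - ((d₂ z + r z : ℝ) : ℂ) * P z) J := by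
  refine (hQ₁.add ((HasACDerivOn.ofReal_mul hJo hP
    (fun z hz => h.hasDerivAt_one z (hJ hz).1 (hJ hz).2) (h.continuousOn_two.mono hJ)).smul
    (-1))).congr (fun z hz => ?_) ?_
  · have hprod := (h.hasDerivAt z (hJ hz).1 (hJ hz).2).ofReal_comp.mul (hP₁ z hz)
    simp only [Pi.add_apply, Pi.smul_apply, smul_eq_mul]
    rw [(hQ z hz).unique hprod]
    ring
  · filter_upwards [hg] with z hz
    simp only [hz, Pi.add_apply, Pi.smul_apply, smul_eq_mul]
    push_cast
    ring

theorem exists_isFluxSolution_of_isImage (h : IsKinked s d d₁ d₂ r) {p g : L2Neg}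
    (hp : IsImage s c d r p g) :
    ∃ P P₁, p =ᵐ[vol₋] P ∧ IsFluxSolution c d d₁ d₂ r P P₁ g := by
  obtain ⟨P, P₁, P₂, Q, Q₁, hP, hpP, hQ, hQl, hQr, hg⟩ := hp
  have hac : HasACDerivOn P P₁ (Iio 0) := .of_hasDerivAt hP.hasDerivAt hP.continuousOn
  have hside : ∀ J : Set ℝ, IsOpen J → OrdConnected J → J ⊆ Iio 0 \ {s} → HasACDerivOn Q Q₁ J →
      HasACDerivOn (fun z => (d z : ℂ) * P₁ z)
        (fun z => g z - ((d₁ z + c : ℝ) : ℂ) * P₁ z - ((d₂ z + r z : ℝ) : ℂ) * P z) J :=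
    fun J hJo _ hJ hQJ => h.hasACDerivOn_flux_of_hasDerivAt hJo hJ
      (hac.mono (hJ.trans sdiff_subset)) (fun z hz => hP.hasDerivAt z (hJ hz).1)
      (fun z hz => hQ z (hJ hz).1 (hJ hz).2) hQJ
      (ae_restrict_of_ae_restrict_of_subset (hJ.trans sdiff_subset) hg)
  have hcont : ContinuousAt (fun z => (d z : ℂ) * P₁ z) s :=
    (Complex.continuous_ofReal.continuousAt.comp h.continuousAt).mul
      (hP.continuousOn.continuousAt (isOpen_Iio.mem_nhds h.neg))
  have hmem := ((Lp.memLp g).sub (memLp_ofReal_mul (h.memLp_drift c) hP.memLp_one)).sub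
    (memLp_ofReal_mul h.memLp_pot hP.memLp)
  exact ⟨P, P₁, hpP, hac, .of_Iio_of_Ioo h.neg
    (hside _ isOpen_Iio ordConnected_Iio (Iio_subset_Iio_diff h.neg) hQl)
    (hside _ isOpen_Ioo ordConnected_Ioo Ioo_subset_Iio_diff hQr) hcont
    (fun x hx y hy => intervalIntegrable_of_memLp one_le_two hmem (le_of_lt hx) (le_of_lt hy)),
    hP.memLp, hP.memLp_one, hP.front⟩

theorem coeFn_fluxSource (h : IsKinked s d d₁ d₂ r) (q g : L2Neg) :
    ⇑(h.lowerOrder c q - h.flux q - g) =ᵐ[vol₋] fun z =>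
      ((d₁ z + c : ℝ) : ℂ) * (backward q z + q z) + ((d₂ z + r z : ℝ) : ℂ) * backward q z -
        (d z : ℂ) * (backward q z + q z) - g z := by
  filter_upwards [Lp.coeFn_sub (h.lowerOrder c q - h.flux q) g,
    Lp.coeFn_sub (h.lowerOrder c q) (h.flux q), h.coeFn_lowerOrder c q, h.coeFn_flux q]
    with z hsub hsub' hlow hflux
  rw [hsub, Pi.sub_apply, hsub', Pi.sub_apply, hlow, hflux]

theorem isFluxSolution_of_flux_eq (h : IsKinked s d d₁ d₂ r) {q g : L2Neg}
    (hq : h.flux q = forwardOp (h.lowerOrder c q - h.flux q - g)) :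
    ∃ P₁, IsFluxSolution c d d₁ d₂ r (backward q) P₁ g := by
  set H := h.lowerOrder c q - h.flux q - g
  have hHm : MemLp H 2 vol₋ := Lp.memLp H
  have hqm : MemLp q 2 vol₋ := Lp.memLp q
  set P₁ : ℝ → ℂ := fun z => (((d z)⁻¹ : ℝ) : ℂ) * forward H z
  have hdP₁ : ∀ z < 0, (d z : ℂ) * P₁ z = forward H z := fun z hz => h.coeff_mul_inv_mul hz _
  have hae : P₁ =ᵐ[vol₋] backward q + q := by
    filter_upwards [coeFn_forwardOp H, h.coeFn_flux q, ae_restrict_mem measurableSet_Iio]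
      with z hforward hflux hz
    rw [← hq, hflux] at hforward
    rw [← h.inv_mul_coeff_mul hz (P₁ z), hdP₁ z hz, ← hforward, h.inv_mul_coeff_mul hz,
      Pi.add_apply]
  refine ⟨P₁, (hasACDerivOn_backward hqm).congr (fun _ _ => rfl) hae,
    (hasACDerivOn_forward hHm).congr hdP₁ ?_, memLp_backward hqm,
    memLp_ofReal_mul h.memLp_inv (memLp_forward hHm), tendsto_backward_zero hqm⟩
  filter_upwards [h.coeFn_fluxSource q g, hae, ae_restrict_mem measurableSet_Iio]
    with z hsource hz hz0
  rw [Pi.sub_apply, Pi.neg_apply, ← hdP₁ z hz0, hsource, hz, Pi.add_apply]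
  ring

theorem exists_flux_eq_of_isFluxSolution (h : IsKinked s d d₁ d₂ r) {p g : L2Neg}
    {P P₁ : ℝ → ℂ} (hp : p =ᵐ[vol₋] P) (hP : IsFluxSolution c d d₁ d₂ r P P₁ g) :
    ∃ q, backwardOp q = p ∧ h.flux q = forwardOp (h.lowerOrder c q - h.flux q - g) := by
  have hqm : MemLp (P₁ - P) 2 vol₋ := hP.memLp_one.sub hP.memLp
  set q : L2Neg := hqm.toLp _
  have hq : q =ᵐ[vol₋] P₁ - P := hqm.coeFn_toLp
  have hback : backward q =ᵐ[vol₋] P := by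
    filter_upwards [ae_restrict_mem measurableSet_Iio] with z hz
    rw [backward_congr hq, ← eqOn_backward hP.hasACDerivOn hP.front hqm hz]
  refine ⟨q, Lp.ext (((coeFn_backwardOp q).trans hback).trans hp.symm), ?_⟩
  set H := h.lowerOrder c q - h.flux q - g
  have hflux : HasACDerivOn (fun z => (d z : ℂ) * P₁ z)
      (-(fun z => (d z : ℂ) * P₁ z) - H) (Iio 0) := by
    refine hP.hasACDerivOn_flux.congr (fun _ _ => rfl) ?_
    filter_upwards [h.coeFn_fluxSource q g, hback, hq] with z hsource hb hz
    rw [Pi.sub_apply, Pi.neg_apply, hsource, hb, hz, Pi.sub_apply]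
    ring
  have heq := eqOn_forward hflux (memLp_ofReal_mul h.memLp_coeff hP.memLp_one) (Lp.memLp H)
  refine Lp.ext ?_
  filter_upwards [coeFn_forwardOp H, h.coeFn_flux q, hback, hq, ae_restrict_mem measurableSet_Iio]
    with z hforward hfluxq hb hz hz0
  rw [hforward, hfluxq, ← heq hz0, hb, hz, Pi.sub_apply, add_sub_cancel]

theorem isImage_iff (h : IsKinked s d d₁ d₂ r) (p g : L2Neg) :
    IsImage s c d r p g ↔
      ∃ q, backwardOp q = p ∧ h.flux q = forwardOp (h.lowerOrder c q - h.flux q - g) := by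
  constructor
  · intro hp
    obtain ⟨P, P₁, hpP, hP⟩ := h.exists_isFluxSolution_of_isImage hp
    exact h.exists_flux_eq_of_isFluxSolution hpP hP
  · rintro ⟨q, rfl, hq⟩
    obtain ⟨P₁, hP⟩ := h.isFluxSolution_of_flux_eq hq
    exact h.isImage_of_isFluxSolution (coeFn_backwardOp q) hP

end IsKinked

theorem IsDissipative.exists_resolvent {s : ℝ} {d d₁ d₂ r : ℝ → ℝ}
    (h : IsDissipative s d d₁ d₂ r) (c : ℝ) {μ : ℂ} (hμ : 0 ≤ μ.re) :
    ∃ B : L2Neg →L[ℂ] L2Neg, (∀ f, IsImage s c d r (B f) (f + μ • B f)) ∧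
      ∀ p g, IsImage s c d r p g → B (g - μ • p) = p := by
  obtain ⟨T, hT⟩ := h.isUnit_formOp c hμ
  have hleft : ∀ q, (↑T⁻¹ : L2Neg →L[ℂ] L2Neg) (h.formOp c μ q) = q := fun q => by
    rw [← hT, ← mul_apply_eq_comp, Units.inv_mul, one_apply_eq_self]
  have hright : ∀ q, h.formOp c μ ((↑T⁻¹ : L2Neg →L[ℂ] L2Neg) q) = q := fun q => by
    rw [← hT, ← mul_apply_eq_comp, Units.mul_inv, one_apply_eq_self]
  refine ⟨backwardOp ∘L (↑T⁻¹ : L2Neg →L[ℂ] L2Neg) ∘L forwardOp, fun f => ?_, fun p g hpg => ?_⟩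
  · exact (h.isImage_iff _ _).2 ⟨_, rfl, (h.formOp_eq_iff c μ _ f).1 (hright _)⟩
  · obtain ⟨q, rfl, hq⟩ := (h.isImage_iff p g).1 hpg
    have hform := (h.formOp_eq_iff c μ q (g - μ • backwardOp q)).2 (by rwa [sub_add_cancel])
    rw [ContinuousLinearMap.comp_apply, ContinuousLinearMap.comp_apply, ← hform, hleft]
/-! ### The coefficients along the wave -/

/-- The values of the wave together with their limits, the set of `u` over which the stability
condition ranges. -/
def waveRange (a b : ℝ) : Set ℝ := Icc 0 (shockLower a b) ∪ Icc (shockUpper a b) 1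

/-- `D(ū)_z` as a function of the value of `ū`, so that `diffusivityZZ` is its derivative along the
wave. -/
def diffusivityZ (a b k u : ℝ) : ℝ := deriv (diffusivity a b) u * waveSlope a b k u

variable {a b k : ℝ}

theorem contDiff_diffusivity (a b : ℝ) : ContDiff ℝ 2 (diffusivity a b) := by
  unfold diffusivity; fun_prop

theorem contDiff_kirchhoff (a b : ℝ) : ContDiff ℝ 2 (kirchhoff a b) := by
  rw [funext (kirchhoff_eq a b)]; fun_prop

theorem deriv_diffusivity (a b : ℝ) : deriv (diffusivity a b) = fun u => 2 * u - a - b :=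
  funext fun u => (hasDerivAt_diffusivity a b u).deriv

theorem isOpen_diffusivity_ne (a b : ℝ) : IsOpen {u | diffusivity a b u ≠ 0} :=
  isOpen_ne.preimage (continuous_diffusivity a b)

theorem contDiffOn_waveSlope (a b k : ℝ) :
    ContDiffOn ℝ 2 (waveSlope a b k) {u | diffusivity a b u ≠ 0} :=
  (contDiff_const.mul (contDiff_kirchhoff a b)).contDiffOn.div
    (contDiff_diffusivity a b).contDiffOn fun _ hu => hu

theorem contDiffOn_diffusivityZ (a b k : ℝ) :
    ContDiffOn ℝ 2 (diffusivityZ a b k) {u | diffusivity a b u ≠ 0} := by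
  unfold diffusivityZ
  rw [deriv_diffusivity]
  exact (by fun_prop : ContDiff ℝ 2 fun u : ℝ => 2 * u - a - b).contDiffOn.mul
    (contDiffOn_waveSlope a b k)

theorem continuousOn_diffusivityZZ (a b k : ℝ) :
    ContinuousOn (diffusivityZZ a b k) {u | diffusivity a b u ≠ 0} :=
  ((contDiffOn_diffusivityZ a b k).continuousOn_deriv_of_isOpen (isOpen_diffusivity_ne a b)
    one_le_two).mul (contDiffOn_waveSlope a b k).continuousOn

theorem continuousOn_deriv_reaction (a b k : ℝ) :
    ContinuousOn (deriv (reaction a b k)) {u | diffusivity a b u ≠ 0} := by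
  refine ContDiffOn.continuousOn_deriv_of_isOpen (n := 2) ?_ (isOpen_diffusivity_ne a b) one_le_two
  unfold reaction
  exact ((contDiffOn_const.div (contDiff_diffusivity a b).contDiffOn fun _ hu => hu).add
    contDiffOn_const).mul (contDiff_kirchhoff a b).contDiffOn

theorem isCompact_waveRange (a b : ℝ) : IsCompact (waveRange a b) :=
  isCompact_Icc.union isCompact_Icc

theorem shockLower_mem_waveRange (hab : a < b) (hneg : b < (a + 2) / 3)
    (hpos : b < a * (2 + √3)) : shockLower a b ∈ waveRange a b :=
  Or.inl (right_mem_Icc.2 (shock_bounds hab hneg hpos).1.le)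

theorem shockUpper_mem_waveRange (hab : a < b) (hneg : b < (a + 2) / 3)
    (hpos : b < a * (2 + √3)) : shockUpper a b ∈ waveRange a b :=
  Or.inr (left_mem_Icc.2 (shock_bounds hab hneg hpos).2.2.2.1.le)

theorem diffusivity_pos_of_mem_waveRange {u : ℝ} (hab : a < b) (hneg : b < (a + 2) / 3)
    (hpos : b < a * (2 + √3)) (hu : u ∈ waveRange a b) : 0 < diffusivity a b u := by
  obtain ⟨-, hl, hr, -⟩ := shock_bounds hab hneg hpos
  rcases hu with hu | hu
  · exact mul_pos_of_neg_of_neg (by linarith [hu.2]) (by linarith [hu.2])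
  · exact mul_pos (by linarith [hu.1]) (by linarith [hu.1])

theorem waveRange_subset_diffusivity_ne (hab : a < b) (hneg : b < (a + 2) / 3)
    (hpos : b < a * (2 + √3)) : waveRange a b ⊆ {u | diffusivity a b u ≠ 0} :=
  fun _ hu => (diffusivity_pos_of_mem_waveRange hab hneg hpos hu).ne'

theorem wave_shockPos (hab : a < b) (hneg : b < (a + 2) / 3) (hpos : b < a * (2 + √3))
    (hk : 0 < k) : wave a b k (shockPos a b k) = shockLower a b := by
  obtain ⟨h0, hl, -⟩ := shock_bounds hab hneg hpos
  rw [wave, if_neg (lt_irrefl _), (shockPos_spec hab hneg hpos hk).2]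
  have hex : ∃ u ∈ Icc 0 (shockLower a b), kirchhoff a b u = kirchhoff a b (shockLower a b) :=
    ⟨_, right_mem_Icc.2 h0.le, rfl⟩
  obtain ⟨hmem, heq⟩ := Function.invFunOn_pos hex
  exact (strictMonoOn_kirchhoff_left hab).injOn (hmem.2.trans hl.le) hl.le heq

theorem wave_mem_waveRange {z : ℝ} (hab : a < b) (hneg : b < (a + 2) / 3)
    (hpos : b < a * (2 + √3)) (hk : 0 < k) (hz : z < 0) : wave a b k z ∈ waveRange a b := by
  rcases lt_trichotomy z (shockPos a b k) with hs | rfl | hs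
  · exact Or.inr (Ioo_subset_Icc_self (wave_left hab hneg hpos hk hs).1)
  · rw [wave_shockPos hab hneg hpos hk]
    exact shockLower_mem_waveRange hab hneg hpos
  · exact Or.inl (Ioo_subset_Icc_self (wave_right hab hneg hpos hk hs hz).1)

theorem tendsto_kirchhoff_mul_exp_shockPos (hab : a < b) (hneg : b < (a + 2) / 3)
    (hpos : b < a * (2 + √3)) (hk : 0 < k) :
    Tendsto (fun z => kirchhoff a b 0 * Real.exp (k * z)) (𝓝 (shockPos a b k))
      (𝓝 (kirchhoff a b (shockLower a b))) := by
  rw [← (shockPos_spec hab hneg hpos hk).2]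
  exact Continuous.tendsto (by fun_prop) _

theorem tendsto_wave_left (hab : a < b) (hneg : b < (a + 2) / 3) (hpos : b < a * (2 + √3))
    (hk : 0 < k) : Tendsto (wave a b k) (𝓝[<] (shockPos a b k)) (𝓝 (shockUpper a b)) := by
  obtain ⟨-, -, hr, -⟩ := shock_bounds hab hneg hpos
  have hmono := strictMonoOn_kirchhoff_right hab
  have hΦ := ((shock_iff hab _ _).2 ⟨rfl, rfl⟩).2.1
  have hexp := (tendsto_kirchhoff_mul_exp_shockPos hab hneg hpos hk).mono_left
    (nhdsWithin_le_nhds (s := Iio (shockPos a b k)))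
  refine tendsto_order.2 ⟨fun v hv => ?_, fun v hv => ?_⟩
  · filter_upwards [self_mem_nhdsWithin] with z hz
    exact hv.trans (wave_left hab hneg hpos hk hz).1.1
  · have hlt : kirchhoff a b (shockLower a b) < kirchhoff a b v :=
      hΦ.trans_lt (hmono hr.le (hr.trans hv).le hv)
    filter_upwards [self_mem_nhdsWithin, hexp.eventually_lt_const hlt] with z hz hzv
    obtain ⟨hmem, heq⟩ := wave_left hab hneg hpos hk hz
    rw [← heq] at hzv
    exact (hmono.lt_iff_lt (hr.trans hmem.1).le (hr.trans hv).le).1 hzv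

theorem tendsto_wave_right (hab : a < b) (hneg : b < (a + 2) / 3) (hpos : b < a * (2 + √3))
    (hk : 0 < k) : Tendsto (wave a b k) (𝓝[>] (shockPos a b k)) (𝓝 (shockLower a b)) := by
  obtain ⟨-, hl, -⟩ := shock_bounds hab hneg hpos
  have hmono := strictMonoOn_kirchhoff_left hab
  have hs := (shockPos_spec hab hneg hpos hk).1
  have hexp := (tendsto_kirchhoff_mul_exp_shockPos hab hneg hpos hk).mono_left
    (nhdsWithin_le_nhds (s := Ioi (shockPos a b k)))
  refine tendsto_order.2 ⟨fun v hv => ?_, fun v hv => ?_⟩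
  · have hlt : kirchhoff a b v < kirchhoff a b (shockLower a b) :=
      hmono (hv.trans hl).le hl.le hv
    filter_upwards [Ioo_mem_nhdsGT hs, hexp.eventually_const_lt hlt] with z hz hzv
    obtain ⟨hmem, heq⟩ := wave_right hab hneg hpos hk hz.1 hz.2
    rw [← heq] at hzv
    exact (hmono.lt_iff_lt (hv.trans hl).le (hmem.2.trans hl).le).1 hzv
  · filter_upwards [Ioo_mem_nhdsGT hs] with z hz
    exact (wave_right hab hneg hpos hk hz.1 hz.2).1.2.trans hv

-- The factor `k Φ / D` is the same on both sides of the shock, and it is negative.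
theorem diffusivityZ_shockUpper_le (hab : a < b) (hneg : b < (a + 2) / 3)
    (hpos : b < a * (2 + √3)) (hk : 0 < k) :
    diffusivityZ a b k (shockUpper a b) ≤ diffusivityZ a b k (shockLower a b) := by
  obtain ⟨-, -, -, -, -, hΦ0⟩ := shock_bounds hab hneg hpos
  obtain ⟨hlr, hΦ, hD⟩ := (shock_iff hab _ _).2 ⟨rfl, rfl⟩
  have hslope : waveSlope a b k (shockLower a b) = waveSlope a b k (shockUpper a b) := by
    rw [waveSlope, waveSlope, hΦ, hD]
  have hslope_neg : waveSlope a b k (shockLower a b) < 0 :=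
    div_neg_of_neg_of_pos (mul_neg_of_pos_of_neg hk hΦ0)
      (diffusivity_pos_of_mem_waveRange hab hneg hpos (shockLower_mem_waveRange hab hneg hpos))
  rw [diffusivityZ, diffusivityZ, ← hslope, deriv_diffusivity]
  exact mul_le_mul_of_nonpos_right (by linarith) hslope_neg.le

theorem continuousAt_diffusivity_wave (hab : a < b) (hneg : b < (a + 2) / 3)
    (hpos : b < a * (2 + √3)) (hk : 0 < k) :
    ContinuousAt (fun z => diffusivity a b (wave a b k z)) (shockPos a b k) := by
  have hD := ((shock_iff hab _ _).2 ⟨rfl, rfl⟩).2.2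
  refine continuousAt_iff_continuous_left'_right'.2 ⟨?_, ?_⟩
  · rw [ContinuousWithinAt, wave_shockPos hab hneg hpos hk, hD]
    exact ((continuous_diffusivity a b).tendsto _).comp (tendsto_wave_left hab hneg hpos hk)
  · rw [ContinuousWithinAt, wave_shockPos hab hneg hpos hk]
    exact ((continuous_diffusivity a b).tendsto _).comp (tendsto_wave_right hab hneg hpos hk)

theorem hasDerivAt_diffusivity_wave {z : ℝ} (hab : a < b) (hneg : b < (a + 2) / 3)
    (hpos : b < a * (2 + √3)) (hk : 0 < k) (hz : z < 0) (hzs : z ≠ shockPos a b k) :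
    HasDerivAt (fun z => diffusivity a b (wave a b k z)) (diffusivityZ a b k (wave a b k z)) z := by
  rw [diffusivityZ, deriv_diffusivity]
  exact (hasDerivAt_diffusivity a b _).comp z (hasDerivAt_wave hab hneg hpos hk hz hzs).1

theorem hasDerivAt_diffusivityZ_wave {z : ℝ} (hab : a < b) (hneg : b < (a + 2) / 3)
    (hpos : b < a * (2 + √3)) (hk : 0 < k) (hz : z < 0) (hzs : z ≠ shockPos a b k) :
    HasDerivAt (fun z => diffusivityZ a b k (wave a b k z)) (diffusivityZZ a b k (wave a b k z))
      z := by
  obtain ⟨hwave, hD⟩ := hasDerivAt_wave hab hneg hpos hk hz hzs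
  have hdiff : DifferentiableAt ℝ (diffusivityZ a b k) (wave a b k z) :=
    ((contDiffOn_diffusivityZ a b k).contDiffAt
      ((isOpen_diffusivity_ne a b).mem_nhds hD.ne')).differentiableAt two_ne_zero
  exact hdiff.hasDerivAt.comp z hwave

theorem bounded_coefficients_waveRange (k : ℝ) (hab : a < b) (hneg : b < (a + 2) / 3)
    (hpos : b < a * (2 + √3)) : ∃ M, ∀ u ∈ waveRange a b, |diffusivity a b u| ≤ M ∧
      |diffusivityZ a b k u| ≤ M ∧ |diffusivityZZ a b k u| ≤ M ∧
      |deriv (reaction a b k) u| ≤ M := by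
  have hcont := (continuous_diffusivity a b).continuousOn.prodMk
    ((contDiffOn_diffusivityZ a b k).continuousOn.prodMk
      ((continuousOn_diffusivityZZ a b k).prodMk (continuousOn_deriv_reaction a b k)))
  obtain ⟨M, hM⟩ := (isCompact_waveRange a b).exists_bound_of_continuousOn
    (hcont.mono (waveRange_subset_diffusivity_ne hab hneg hpos))
  exact ⟨M, fun u hu => by simpa only [norm_prod_le_iff, Real.norm_eq_abs] using hM u hu⟩

theorem isKinked_wave (hab : a < b) (hneg : b < (a + 2) / 3) (hpos : b < a * (2 + √3))
    (hk : 0 < k) :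
    IsKinked (shockPos a b k) (fun z => diffusivity a b (wave a b k z))
      (fun z => diffusivityZ a b k (wave a b k z)) (fun z => diffusivityZZ a b k (wave a b k z))
      (fun z => deriv (reaction a b k) (wave a b k z)) := by
  have hmem : ∀ z < 0, wave a b k z ∈ waveRange a b := fun z hz =>
    wave_mem_waveRange hab hneg hpos hk hz
  have hcont : ContinuousOn (wave a b k) (Iio 0 \ {shockPos a b k}) := fun z hz =>
    (hasDerivAt_wave hab hneg hpos hk hz.1 hz.2).1.continuousAt.continuousWithinAt
  have hmaps : MapsTo (wave a b k) (Iio 0 \ {shockPos a b k}) {u | diffusivity a b u ≠ 0} :=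
    fun z hz => waveRange_subset_diffusivity_ne hab hneg hpos (hmem z hz.1)
  exact {
    neg := (shockPos_spec hab hneg hpos hk).1
    hasDerivAt := fun z => hasDerivAt_diffusivity_wave hab hneg hpos hk
    hasDerivAt_one := fun z => hasDerivAt_diffusivityZ_wave hab hneg hpos hk
    continuousAt := continuousAt_diffusivity_wave hab hneg hpos hk
    continuousOn_two := (continuousOn_diffusivityZZ a b k).comp hcont hmaps
    continuousOn_pot := (continuousOn_deriv_reaction a b k).comp hcont hmaps
    bounded := by
      obtain ⟨M, hM⟩ := bounded_coefficients_waveRange k hab hneg hpos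
      exact ⟨M, fun z hz _ => hM _ (hmem z hz)⟩
    pos := by
      obtain ⟨u, hu, hmin⟩ := (isCompact_waveRange a b).exists_isMinOn
        ⟨_, shockLower_mem_waveRange hab hneg hpos⟩ (continuous_diffusivity a b).continuousOn
      exact ⟨_, diffusivity_pos_of_mem_waveRange hab hneg hpos hu, fun z hz => hmin (hmem z hz)⟩ }

theorem isDissipative_wave (hab : a < b) (hneg : b < (a + 2) / 3) (hpos : b < a * (2 + √3))
    (hk : 0 < k)
    (hstab : ∀ u ∈ waveRange a b,
      1 / 2 * diffusivityZZ a b k u + deriv (reaction a b k) u < 0) :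
    IsDissipative (shockPos a b k) (fun z => diffusivity a b (wave a b k z))
      (fun z => diffusivityZ a b k (wave a b k z)) (fun z => diffusivityZZ a b k (wave a b k z))
      (fun z => deriv (reaction a b k) (wave a b k z)) := by
  have hsub := waveRange_subset_diffusivity_ne hab hneg hpos
  have hlower := shockLower_mem_waveRange hab hneg hpos
  have hcontAt : ∀ u ∈ waveRange a b, ContinuousAt (diffusivityZ a b k) u := fun u hu =>
    (contDiffOn_diffusivityZ a b k).continuousOn.continuousAt
      ((isOpen_diffusivity_ne a b).mem_nhds (hsub hu))
  refine ⟨isKinked_wave hab hneg hpos hk, ?_, ?_⟩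
  · obtain ⟨u, hu, hmax⟩ := (isCompact_waveRange a b).exists_isMaxOn ⟨_, hlower⟩
      (((continuousOn_diffusivityZZ a b k).const_mul (1 / 2)).add
        (continuousOn_deriv_reaction a b k) |>.mono hsub)
    refine ⟨_, neg_pos.2 (hstab u hu), fun z hz _ => ?_⟩
    rw [neg_neg]
    exact hmax (wave_mem_waveRange hab hneg hpos hk hz)
  · exact ⟨_, _,
      (hcontAt _ (shockUpper_mem_waveRange hab hneg hpos)).tendsto.comp
        (tendsto_wave_left hab hneg hpos hk),
      (hcontAt _ hlower).tendsto.comp (tendsto_wave_right hab hneg hpos hk),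
      diffusivityZ_shockUpper_le hab hneg hpos hk⟩

/-! ### The spectrum -/

theorem notMem_spectrumOp {E : Type*} [NormedAddCommGroup E] [NormedSpace ℂ E] {T : E →ₗ.[ℂ] E}
    {μ : ℂ} (B : E →L[ℂ] E) (hright : ∀ f, (B f, f + μ • B f) ∈ T.graph)
    (hleft : ∀ p g, (p, g) ∈ T.graph → B (g - μ • p) = p) : μ ∉ spectrumOp T := by
  refine fun hμ => hμ ⟨B, fun f => ?_, fun p => hleft _ _ (T.mem_graph p)⟩
  obtain ⟨p, hp, hTp⟩ := T.mem_graph_iff.1 (hright f)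
  dsimp only at hp hTp
  have hmem : B f ∈ T.domain := hp ▸ p.2
  refine ⟨hmem, ?_⟩
  rw [show (⟨B f, hmem⟩ : T.domain) = p from Subtype.ext hp.symm, hTp, add_sub_cancel_right]

end

end RecedingWave

theorem theorem1 (a b k : ℝ) (ha : 0 < a) (hab : a < b) (hb : b < 1)
    (hneg : b < (a + 2) / 3) (hpos : b < a * (2 + √3)) (hk : 0 < k)
    (hstab : ∀ u ∈ Set.Icc 0 (RecedingWave.shockLower a b) ∪ Set.Icc (RecedingWave.shockUpper a b) 1,
      1 / 2 * RecedingWave.diffusivityZZ a b k u + deriv (RecedingWave.reaction a b k) u < 0) :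
    RecedingWave.SpectrallyStable (RecedingWave.linearisedOperator a b k) := by
  intro μ hμ
  by_contra! hre
  have hdiss := RecedingWave.isDissipative_wave hab hneg hpos hk hstab
  obtain ⟨B, hright, hleft⟩ := hdiss.exists_resolvent (RecedingWave.speed a b k) hre
  exact RecedingWave.notMem_spectrumOp B
    (fun f => (RecedingWave.mem_graph_linearisedOperator a b k _ _).2 (hright f))
    (fun p g hpg => hleft p g ((RecedingWave.mem_graph_linearisedOperator a b k _ _).1 hpg)) hμ
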